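/- **Setting.** There are $n$ advertisers and $m\ge 1$ slots with effects $s_1>s_2>\dots>s_m>0$; put $s_k=0$ for $k>m$. Advertiser $i$ has a value per click $\theta_i\ge 0$ and a relevance $w_i>0$; displayed in slot $k$ it is clicked at rate $w_is_k$. The values are i.i.d. with cdf $F$ and density $f$, where $F(0)=0$ and $F(t)>0$ for all $t>0$, and are independent of the relevance vector $w=(w_1,\dots,w_n)$, which has an arbitrary joint law with $\mathbb E\,w_i<\infty$ and $\mathbb P(w_i\ne w_j\text{ for some }i,j)>0$. On $\{t>0: F(t)<1\}$ the hazard rate $f/(1-F)$ is non-decreasing and the virtual value $\phi(t)=t-\frac{1-F(t)}{f(t)}$ is differentiable. Given a ranking function $y(b,w)\ge 0$ and bids $b_i$, advertisers are sorted by decreasing score $y(b_i,w_i)$ (ties broken in any way), the one in position $k$ getting slot $k$; advertisers with score $0$ are excluded. Let $x_i$ be the effect of the slot of advertiser $i$ ($0$ if $i$ is not displayed), and let $q_k$ be the score of the advertiser in position $k+1$ ($0$ if there is none). The price per click of position $k$ for advertiser $i$ is $p_i(k)=\inf\{b: y(b,w_i)>q_k\}$. With $k_i$ the position of $i$, the outcome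 is a *symmetric Nash equilibrium* (SNE) if $$(\theta_i-p_i(k_i))\,x_i\ \ge\ (\theta_i-p_i(k))\,s_k\qquad\text{for all advertisers } i\text{ and all positions }k\ge 1$$ (vacant slots and the option of not being displayed included). Its revenue is $\sum_i p_i(k_i)w_ix_i$, and it is a *lowest* SNE if no SNE for the same $(\theta,w)$ has smaller revenue. A (measurable) rule that selects an SNE for almost every realisation $(\theta,w)$, with resulting allocation rule $x(\theta,w)$, *respects the bound* if its expected revenue is at most $R(x)=\mathbb E\bigl[\sum_i\phi(\theta_i)w_ix_i(\theta,w)\bigr]$. **Theorem.** Let $\phi(\bar\theta)=0$ and $r\in(0,\bar\theta]$, and suppose $$r\ \le\ \inf_{t\ge r,\ F(t)<1}\Bigl\{t-\frac{\phi(t)}{\phi'(t)}\Bigr\}.$$ Let $R_1$ be the expected revenue of a rule that selects SNE under the ranking function $(b-r)^+w$ and that either respects the bound or selects lowest SNE. Let $R_2$ be the expected revenue of a rule that selects SNE under the ranking function $\mathbf 1\{b\ge r\}\,bw$ and respects the bound. Then $R_1>R_2$. -/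

import Mathlib

open MeasureTheory

noncomputable section

namespace GSP

/-! ### Distribution of the values -/

/-- The law on `ℝ` with probability density `f`. -/
def valueLaw (f : ℝ → ℝ) : Measure ℝ :=
  volume.withDensity fun t => ENNReal.ofReal (f t)

/-- The cumulative distribution function `F` of the law with density `f`. -/
def valueCDF (f : ℝ → ℝ) (t : ℝ) : ℝ := ProbabilityTheory.cdf (valueLaw f) t

/-- The virtual value `φ(t) = t - (1 - F(t)) / f(t)`. -/
def virtualValue (f : ℝ → ℝ) (t : ℝ) : ℝ := t - (1 - valueCDF f t) / f t

/-- The positive points below the (possibly infinite) upper end of the range of the values. -/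
def valueRange (f : ℝ → ℝ) : Set ℝ := {t | 0 < t ∧ valueCDF f t < 1}

/-- `f` is a density of nonnegative values with support at zero, with non-decreasing hazard rate
and differentiable virtual value function. -/
structure IsRegularDensity (f : ℝ → ℝ) : Prop where
  measurable : Measurable f
  nonneg : ∀ t, 0 ≤ f t
  isProbabilityMeasure : IsProbabilityMeasure (valueLaw f)
  cdf_zero : valueCDF f 0 = 0
  support_at_zero : ∀ t, 0 < t → 0 < valueCDF f t
  hazard_monotone : MonotoneOn (fun t => f t / (1 - valueCDF f t)) (valueRange f)
  differentiable : DifferentiableOn ℝ (virtualValue f) (valueRange f)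

/-- A realisation `(θ, w)` of the values and of the relevances of `n` advertisers. -/
abbrev Types (n : ℕ) : Type := (Fin n → ℝ) × (Fin n → ℝ)

/-- The law of the types: values are i.i.d. with density `f`, and independent of the relevances,
whose joint law is `ν`. -/
def typeLaw {n : ℕ} (f : ℝ → ℝ) (ν : Measure (Fin n → ℝ)) : Measure (Types n) :=
  (Measure.pi fun _ => valueLaw f).prod ν

/-! ### Ranking functions and the generalised second price -/

/-- The ranking function `(b - r)⁺ w`. -/
def proposedRanking (r b w : ℝ) : ℝ := max (b - r) 0 * w

/-- The ranking function `𝟙{b ≥ r} b w`. -/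
def standardRanking (r b w : ℝ) : ℝ := if r ≤ b then b * w else 0

/-- The price per click of an advertiser with relevance `w` whose score has to exceed `q`. -/
def price (y : ℝ → ℝ → ℝ) (q w : ℝ) : ℝ := sInf {b | q < y b w}

/-- The effect of the `k`-th slot (counted from `0`); there is nothing beyond the last slot. -/
def slotEffect {m : ℕ} (s : Fin m → ℝ) (k : ℕ) : ℝ := if h : k < m then s ⟨k, h⟩ else 0

/-- An outcome of the auction: the bids, and the position of each advertiser in the ranking
(counted from `0`). -/
structure Outcome (n : ℕ) where
  bid : Fin n → ℝ
  rank : Equiv.Perm (Fin n)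

namespace Outcome

variable {n m : ℕ}

/-- The advertisers are sorted by their scores (ties may be broken in any way). -/
def IsSorted (y : ℝ → ℝ → ℝ) (w : Fin n → ℝ) (o : Outcome n) : Prop :=
  ∀ i j, o.rank i < o.rank j → y (o.bid j) (w j) ≤ y (o.bid i) (w i)

/-- The score of the advertiser in the position after the `k`-th, and `0` if there is none. -/
def nextScore (y : ℝ → ℝ → ℝ) (w : Fin n → ℝ) (o : Outcome n) (k : ℕ) : ℝ :=
  if h : k + 1 < n then
    y (o.bid (o.rank.symm ⟨k + 1, h⟩)) (w (o.rank.symm ⟨k + 1, h⟩))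
  else 0

/-- The allocation `x_i`: the effect of the slot of advertiser `i`. Advertisers with score `0` are
excluded. -/
def alloc (y : ℝ → ℝ → ℝ) (s : Fin m → ℝ) (w : Fin n → ℝ) (o : Outcome n) (i : Fin n) : ℝ :=
  if 0 < y (o.bid i) (w i) then slotEffect s (o.rank i) else 0

/-- What an advertiser with relevance `v` pays per click in position `k`. -/
def priceAt (y : ℝ → ℝ → ℝ) (w : Fin n → ℝ) (o : Outcome n) (k : ℕ) (v : ℝ) : ℝ :=
  price y (o.nextScore y w k) v

/-- Symmetric Nash equilibrium at the realisation `p = (θ, w)`: no advertiser prefers another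
position at the price that goes with that position. The positions include vacant slots, and those
beyond the last slot, which amount to not being displayed. -/
def IsSNE (y : ℝ → ℝ → ℝ) (s : Fin m → ℝ) (p : Types n) (o : Outcome n) : Prop :=
  o.IsSorted y p.2 ∧
    ∀ (i : Fin n) (k : ℕ),
      (p.1 i - o.priceAt y p.2 k (p.2 i)) * slotEffect s k ≤
        (p.1 i - o.priceAt y p.2 (o.rank i) (p.2 i)) * o.alloc y s p.2 i

/-- The revenue: advertiser `i` gets `w_i x_i` clicks in expectation. -/
def revenue (y : ℝ → ℝ → ℝ) (s : Fin m → ℝ) (w : Fin n → ℝ) (o : Outcome n) : ℝ :=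
  ∑ i, o.priceAt y w (o.rank i) (w i) * w i * o.alloc y s w i

/-- A symmetric Nash equilibrium whose revenue is the lowest among all of them. -/
def IsLowestSNE (y : ℝ → ℝ → ℝ) (s : Fin m → ℝ) (p : Types n) (o : Outcome n) : Prop :=
  o.IsSNE y s p ∧ ∀ o' : Outcome n, o'.IsSNE y s p → o.revenue y s p.2 ≤ o'.revenue y s p.2

end Outcome

/-! ### Rules that select an outcome for every realisation of the types -/

section Selection

variable {n m : ℕ}

/-- Measurability of a rule that selects an outcome for each realisation of the types. -/
def IsMeasurableRule (P : Measure (Types n)) (o : Types n → Outcome n) : Prop :=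
  ∀ i, AEMeasurable (fun p => (o p).bid i) P ∧ AEMeasurable (fun p => (o p).rank i) P

/-- The rule selects symmetric Nash equilibria. -/
def SelectsSNE (y : ℝ → ℝ → ℝ) (s : Fin m → ℝ) (P : Measure (Types n))
    (o : Types n → Outcome n) : Prop :=
  IsMeasurableRule P o ∧ ∀ᵐ p ∂P, (o p).IsSNE y s p

/-- The rule selects symmetric Nash equilibria of lowest revenue. -/
def SelectsLowestSNE (y : ℝ → ℝ → ℝ) (s : Fin m → ℝ) (P : Measure (Types n))
    (o : Types n → Outcome n) : Prop :=
  IsMeasurableRule P o ∧ ∀ᵐ p ∂P, (o p).IsLowestSNE y s p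

/-- The expected revenue of the rule. -/
def expectedRevenue (y : ℝ → ℝ → ℝ) (s : Fin m → ℝ) (P : Measure (Types n))
    (o : Types n → Outcome n) : ℝ :=
  ∫ p, (o p).revenue y s p.2 ∂P

/-- The expected virtual surplus `E[∑ φ(θ_i) w_i x_i(θ, w)]` of the allocation rule `x` that the
rule `o` defines. -/
def virtualSurplus (f : ℝ → ℝ) (y : ℝ → ℝ → ℝ) (s : Fin m → ℝ) (P : Measure (Types n))
    (o : Types n → Outcome n) : ℝ :=
  ∫ p, ∑ i, virtualValue f (p.1 i) * p.2 i * (o p).alloc y s p.2 i ∂P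

/-- The expected revenue does not exceed that of the optimal Bayes-Nash equilibrium with the same
allocation rule. -/
def RespectsBound (f : ℝ → ℝ) (y : ℝ → ℝ → ℝ) (s : Fin m → ℝ) (P : Measure (Types n))
    (o : Types n → Outcome n) : Prop :=
  expectedRevenue y s P o ≤ virtualSurplus f y s P o

end Selection

end GSP

end

/-!
Write `φ(t) = t - h(t)` with the inverse hazard rate `h`. The condition on `r` says that
`t ↦ φ(t) / (t - r)` is non-decreasing above `r`.

Under the proposed ranking the net values `(θ_i - r)⁺ w_i` are envy-free at the next scores, so they
sort the advertisers. Chaining the envy-freeness conditions down the ranking bounds the utility of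
`i` by the integral over `t ∈ (r, θ_i)` of the clicks that `i` would be entitled to with the value
`t`. Integrating out `θ_i` (Fubini) turns the expected bound into `E[h(θ_i) w_i x_i]`, whence the
expected revenue, surplus minus utilities, is at least the virtual surplus, whichever equilibria are
selected.

Where an equilibrium under the standard ranking orders two advertisers differently, the one that the
proposed ranking prefers is the less relevant one, and the condition on `r` makes its virtual value
per impression `φ(θ_i) w_i` at least as large. By rearrangement the proposed ranking has the larger
virtual surplus for all types, strictly so when exactly two advertisers, of different relevances,
are above `r` and subtracting `r` swaps them, which has positive probability. Thus
`R₂ ≤ R(x₂) < R(x₁) ≤ R₁`.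
-/

noncomputable section

namespace GSP

section SlotEffect

variable {m : ℕ} {s : Fin m → ℝ}

lemma slotEffect_of_le {k : ℕ} (hk : m ≤ k) : slotEffect s k = 0 :=
  dif_neg hk.not_gt

lemma slotEffect_nonneg (hS : Antitone (slotEffect s)) (k : ℕ) : 0 ≤ slotEffect s k :=
  (slotEffect_of_le (le_max_right k m)).symm.trans_le (hS (le_max_left k m))

lemma slotEffect_antitone (hs : Antitone s) (hs_nonneg : ∀ k, 0 ≤ s k) :
    Antitone (slotEffect s) := by
  intro k l hkl
  unfold slotEffect
  split_ifs with hl hk hk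
  · exact hs hkl
  · exact absurd (hkl.trans_lt hl) hk
  · exact hs_nonneg _
  · exact le_rfl

lemma slotEffect_one_lt_zero (hs : StrictAnti s) (hs_pos : ∀ k, 0 < s k) (hm : 0 < m) :
    slotEffect s 1 < slotEffect s 0 := by
  unfold slotEffect
  rw [dif_pos hm]
  split_ifs
  · exact hs (by simp)
  · exact hs_pos _

end SlotEffect

/-! ### Comparison of two rankings -/

section Rearrangement

lemma rank_eq_zero {ι : Type*} {n : ℕ} {ρ : ι ≃ Fin n} {S : ℕ → ℝ} (hS : Antitone S)
    (h01 : S 1 < S 0) {i : ι} (h : ∀ l, S (ρ l) ≤ S (ρ i)) : (ρ i : ℕ) = 0 := by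
  by_contra hi
  have hfirst : S (ρ (ρ.symm ⟨0, (ρ i).pos⟩)) = S 0 := by rw [Equiv.apply_symm_apply]
  exact (((hS (Nat.one_le_iff_ne_zero.mpr hi)).trans_lt h01).trans_eq hfirst.symm).not_ge (h _)

lemma sum_le_sum_of_card_eq {ι : Type*} [DecidableEq ι] {T U : Finset ι} {a : ι → ℝ}
    (hcard : T.card = U.card) (h : ∀ i ∈ T \ U, ∀ j ∈ U \ T, a j ≤ a i) :
    ∑ i ∈ U, a i ≤ ∑ i ∈ T, a i := by
  suffices ∑ j ∈ U \ T, a j ≤ ∑ i ∈ T \ U, a i by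
    rw [← Finset.sum_inter_add_sum_sdiff T U a, ← Finset.sum_inter_add_sum_sdiff U T a,
      Finset.inter_comm U T]
    gcongr
  let e : ↥(U \ T) ≃ ↥(T \ U) := Finset.equivOfCardEq (Finset.card_sdiff_comm hcard.symm)
  calc ∑ j ∈ U \ T, a j = ∑ j : ↥(U \ T), a j := (Finset.sum_coe_sort _ _).symm
    _ ≤ ∑ j : ↥(U \ T), a (e j) := Finset.sum_le_sum fun j _ => h _ (e j).2 _ j.2
    _ = ∑ i : ↥(T \ U), a i := e.sum_comp fun i => a i
    _ = ∑ i ∈ T \ U, a i := Finset.sum_coe_sort _ _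

variable {ι : Type*} [Fintype ι] {n : ℕ}

/-- The set of those in the positions `0, …, k` of a ranking. -/
def topSet (ρ : ι ≃ Fin n) (k : ℕ) : Finset ι := {i | (ρ i : ℕ) ≤ k}

lemma mem_topSet {ρ : ι ≃ Fin n} {k : ℕ} {i : ι} : i ∈ topSet ρ k ↔ (ρ i : ℕ) ≤ k := by
  simp [topSet]

lemma card_topSet (ρ : ι ≃ Fin n) {k : ℕ} (hk : k < n) : (topSet ρ k).card = k + 1 :=
  calc (topSet ρ k).card = (Finset.Iic (⟨k, hk⟩ : Fin n)).card :=
        Finset.card_equiv ρ fun i => by simp [mem_topSet, Fin.le_def]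
    _ = k + 1 := Fin.card_Iic _

lemma topSet_zero {ρ : ι ≃ Fin n} {i : ι} (hi : (ρ i : ℕ) = 0) : topSet ρ 0 = {i} := by
  ext j
  rw [mem_topSet, Finset.mem_singleton, ← ρ.injective.eq_iff, Fin.ext_iff, hi, Nat.le_zero]

lemma sum_mul_rank_eq (ρ : ι ≃ Fin n) (S : ℕ → ℝ) (a : ι → ℝ) :
    ∑ i, a i * S (ρ i) =
      S n * ∑ i, a i + ∑ k ∈ Finset.range n, (S k - S (k + 1)) * ∑ i ∈ topSet ρ k, a i := by
  have telescope (i : ι) :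
      S (ρ i) = S n + ∑ k ∈ Finset.range n, if (ρ i : ℕ) ≤ k then S k - S (k + 1) else 0 := by
    have hset : {k ∈ Finset.range n | (ρ i : ℕ) ≤ k} = Finset.Ico (ρ i : ℕ) n := by
      ext k
      simp [and_comm]
    rw [← Finset.sum_filter, hset, ← neg_inj, neg_add, ← Finset.sum_neg_distrib]
    simp_rw [neg_sub]
    rw [Finset.sum_Ico_sub (f := S) (ρ i).is_lt.le]
    ring
  calc ∑ i, a i * S (ρ i)
      = ∑ i, (S n * a i +
          ∑ k ∈ Finset.range n, if (ρ i : ℕ) ≤ k then (S k - S (k + 1)) * a i else 0) := by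
        refine Finset.sum_congr rfl fun i _ => ?_
        rw [telescope i, mul_comm, add_mul, Finset.sum_mul]
        simp_rw [ite_mul, zero_mul]
    _ = _ := by
        rw [Finset.sum_add_distrib, ← Finset.mul_sum, Finset.sum_comm]
        simp_rw [topSet, Finset.mul_sum, Finset.sum_filter]

variable {ρ σ : ι ≃ Fin n} {S : ℕ → ℝ} {a : ι → ℝ}

lemma drop_mul_sum_topSet_le (hS : Antitone S)
    (h : ∀ i j, S (ρ j) < S (ρ i) → S (σ i) < S (σ j) → a j ≤ a i) {k : ℕ} (hk : k < n) :
    (S k - S (k + 1)) * ∑ i ∈ topSet σ k, a i ≤ (S k - S (k + 1)) * ∑ i ∈ topSet ρ k, a i := by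
  classical
  rcases (hS k.le_succ).eq_or_lt with hdrop | hdrop
  · rw [Nat.succ_eq_add_one] at hdrop
    simp only [hdrop, sub_self, zero_mul, le_refl]
  refine mul_le_mul_of_nonneg_left ?_ (sub_nonneg.mpr hdrop.le)
  refine sum_le_sum_of_card_eq ((card_topSet ρ hk).trans (card_topSet σ hk).symm)
    fun i hi j hj => ?_
  simp only [Finset.mem_sdiff, mem_topSet, not_le] at hi hj
  exact h i j ((hS hj.2).trans_lt (hdrop.trans_le (hS hi.1)))
    ((hS hi.2).trans_lt (hdrop.trans_le (hS hj.1)))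

lemma sum_mul_rank_le (hS : Antitone S)
    (h : ∀ i j, S (ρ j) < S (ρ i) → S (σ i) < S (σ j) → a j ≤ a i) :
    ∑ i, a i * S (σ i) ≤ ∑ i, a i * S (ρ i) := by
  rw [sum_mul_rank_eq, sum_mul_rank_eq]
  exact add_le_add le_rfl
    (Finset.sum_le_sum fun k hk => drop_mul_sum_topSet_le hS h (Finset.mem_range.mp hk))

lemma sum_mul_rank_lt (hS : Antitone S)
    (h : ∀ i j, S (ρ j) < S (ρ i) → S (σ i) < S (σ j) → a j ≤ a i)
    (h01 : S 1 < S 0) {i j : ι} (hi : (ρ i : ℕ) = 0) (hj : (σ j : ℕ) = 0) (hij : a j < a i) :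
    ∑ i, a i * S (σ i) < ∑ i, a i * S (ρ i) := by
  rw [sum_mul_rank_eq, sum_mul_rank_eq]
  refine add_lt_add_of_le_of_lt le_rfl <| Finset.sum_lt_sum
    (fun k hk => drop_mul_sum_topSet_le hS h (Finset.mem_range.mp hk))
    ⟨0, Finset.mem_range.mpr (ρ i).pos, ?_⟩
  rw [topSet_zero hi, topSet_zero hj, Finset.sum_singleton, Finset.sum_singleton]
  exact mul_lt_mul_of_pos_left hij (sub_pos.mpr h01)

end Rearrangement

/-! ### Envy-free assignments -/

/-- The number of competitors of `i` whose value exceeds `z`. -/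
def numAbove {ι : Type*} [Fintype ι] [DecidableEq ι] (v : ι → ℝ) (i : ι) (z : ℝ) : ℕ :=
  Finset.card {j | j ≠ i ∧ z < v j}

/-- Position `k` comes with the slot effect `S k` and the price `q k` per unit of that effect, and
nobody with the values `v`, ranked by `ρ`, prefers another position to the own one. -/
def IsEnvyFree {ι : Type*} {n : ℕ} (S q : ℕ → ℝ) (v : ι → ℝ) (ρ : ι ≃ Fin n) : Prop :=
  ∀ (i : ι) (k : ℕ), (v i - q k) * S k ≤ (v i - q (ρ i)) * S (ρ i)

section EnvyFree

variable {ι : Type*} {n : ℕ} {S q : ℕ → ℝ} {v : ι → ℝ} {ρ : ι ≃ Fin n} {i j : ι}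

lemma IsEnvyFree.le_of_slot_lt (h : IsEnvyFree S q v ρ) (hij : S (ρ j) < S (ρ i)) : v j ≤ v i := by
  have hi := h i (ρ j)
  have hj := h j (ρ i)
  refine le_of_mul_le_mul_right ?_ (sub_pos.mpr hij)
  linarith

lemma IsEnvyFree.utility_le_add (h : IsEnvyFree S q v ρ) (i j : ι) :
    (v i - q (ρ i)) * S (ρ i) ≤ (v j - q (ρ j)) * S (ρ j) + S (ρ i) * (v i - v j) := by
  linarith [h j (ρ i)]

variable [Fintype ι] [DecidableEq ι]

lemma numAbove_antitone (v : ι → ℝ) (i : ι) : Antitone (numAbove v i) := fun _ _ hab =>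
  Finset.card_le_card (Finset.monotone_filter_right _ fun _ _ h => ⟨h.1, hab.trans_lt h.2⟩)

lemma intervalIntegrable_numAbove (hS : Antitone S) (v : ι → ℝ) (i : ι) (a b : ℝ) :
    IntervalIntegrable (fun z => S (numAbove v i z)) volume a b :=
  (hS.comp (numAbove_antitone v i)).intervalIntegrable

lemma numAbove_eq_numAbove {z : ℝ} (hi : z < v i) (hj : z < v j) :
    numAbove v i z = numAbove v j z := by
  have erase (l : ι) (hl : z < v l) :
      numAbove v l z = Finset.card {k | z < v k} - 1 := by
    rw [← Finset.card_erase_of_mem (a := l) (by simpa using hl), numAbove]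
    congr 1
    ext k
    simp
  rw [erase i hi, erase j hj]

lemma le_slot_numAbove (hS : Antitone S) {z : ℝ} (h : ∀ j, S (ρ j) < S (ρ i) → v j ≤ z) :
    S (ρ i) ≤ S (numAbove v i z) := by
  by_contra! hlt
  have hmem : ∀ j ∈ insert i (Finset.univ.filter fun j => j ≠ i ∧ z < v j),
      (ρ j : ℕ) ∈ Finset.range (numAbove v i z) := by
    intro j hj
    refine Finset.mem_range.mpr (hS.reflect_lt (hlt.trans_le ?_))
    rcases Finset.mem_insert.mp hj with rfl | hj
    · exact le_rfl
    · exact not_lt.mp fun hji => (Finset.mem_filter.mp hj).2.2.not_ge (h j hji)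
  have hcard := Finset.card_le_card_of_injOn (fun j => (ρ j : ℕ)) hmem
    (Fin.val_injective.comp ρ.injective).injOn
  rw [Finset.card_insert_of_notMem (by simp), Finset.card_range] at hcard
  exact Nat.not_succ_le_self _ hcard

lemma IsEnvyFree.slot_numAbove_le (h : IsEnvyFree S q v ρ) (hS : Antitone S)
    (hties : ∀ j, j ≠ i → v j ≠ v i) : S (numAbove v i (v i)) ≤ S (ρ i) := by
  by_contra! hlt
  have hN : numAbove v i (v i) < ρ i := hS.reflect_lt hlt
  have hsub : topSet ρ (numAbove v i (v i)) ⊆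
      Finset.univ.filter fun j => j ≠ i ∧ v i < v j := by
    intro j hj
    rw [mem_topSet] at hj
    have hji : j ≠ i := by
      rintro rfl
      exact hj.not_gt hN
    exact Finset.mem_filter.mpr ⟨Finset.mem_univ j, hji,
      (h.le_of_slot_lt (hlt.trans_le (hS hj))).lt_of_ne (hties j hji).symm⟩
  have hcard := Finset.card_le_card hsub
  rw [card_topSet ρ (hN.trans (ρ i).is_lt)] at hcard
  exact Nat.not_succ_le_self _ hcard

/-- Envy-freeness of the highest value `v j` among those with smaller effects bounds the utility of
`i` by that of `j` plus `S (ρ i) * (v i - v j)`; one continues with `j`. -/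
lemma IsEnvyFree.utility_le_integral (h : IsEnvyFree S q v ρ) (hS : Antitone S)
    (hS_nonneg : ∀ k, 0 ≤ S k) (hq : ∀ k, 0 ≤ q k) (hv : ∀ i, 0 ≤ v i) (i : ι) :
    (v i - q (ρ i)) * S (ρ i) ≤ ∫ z in 0..v i, S (numAbove v i z) := by
  have last_step (i : ι) {a : ℝ} (hai : a ≤ v i) (ha : ∀ j, S (ρ j) < S (ρ i) → v j ≤ a) :
      S (ρ i) * (v i - a) ≤ ∫ z in a..v i, S (numAbove v i z) :=
    calc S (ρ i) * (v i - a) = ∫ _ in a..v i, S (ρ i) := by simp [mul_comm]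
      _ ≤ _ := intervalIntegral.integral_mono_on hai intervalIntegrable_const
          (intervalIntegrable_numAbove hS v i _ _)
          fun z hz => le_slot_numAbove hS fun j hj => (ha j hj).trans hz.1
  have hwf : WellFounded fun j i => S (ρ j) < S (ρ i) :=
    haveI : IsStrictOrder ι fun j i => S (ρ j) < S (ρ i) :=
      { irrefl := fun _ => lt_irrefl _, trans := fun _ _ _ => lt_trans }
    Finite.wellFounded_of_trans_of_irrefl _
  induction i using hwf.induction with
  | _ i ih =>
    rcases (Finset.univ.filter fun j => S (ρ j) < S (ρ i)).eq_empty_or_nonempty with he | hne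
    · calc (v i - q (ρ i)) * S (ρ i) ≤ S (ρ i) * (v i - 0) := by
            nlinarith [mul_nonneg (hq (ρ i)) (hS_nonneg (ρ i))]
        _ ≤ _ := last_step i (hv i) fun j hj =>
            absurd hj (Finset.filter_eq_empty_iff.mp he (Finset.mem_univ j))
    · obtain ⟨j, hj, hmax⟩ := Finset.exists_max_image _ v hne
      simp only [Finset.mem_filter_univ] at hj hmax
      have hji : v j ≤ v i := h.le_of_slot_lt hj
      have hsame : ∫ z in 0..v j, S (numAbove v j z) = ∫ z in 0..v j, S (numAbove v i z) := by
        refine intervalIntegral.integral_congr_Ioo_of_le (hv j) fun z hz => ?_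
        simp only [numAbove_eq_numAbove (hz.2.trans_le hji) hz.2]
      calc (v i - q (ρ i)) * S (ρ i)
          ≤ (v j - q (ρ j)) * S (ρ j) + S (ρ i) * (v i - v j) := h.utility_le_add i j
        _ ≤ (∫ z in 0..v j, S (numAbove v i z)) + ∫ z in v j..v i, S (numAbove v i z) :=
            add_le_add ((ih j hj).trans_eq hsame) (last_step i hji hmax)
        _ = ∫ z in 0..v i, S (numAbove v i z) :=
            intervalIntegral.integral_add_adjacent_intervals
              (intervalIntegrable_numAbove hS v i _ _) (intervalIntegrable_numAbove hS v i _ _)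

end EnvyFree

/-! ### Symmetric Nash equilibria with a reserve price -/

section Price

variable {r q w : ℝ}

lemma price_proposedRanking (hq : 0 ≤ q) (hw : 0 < w) :
    price (proposedRanking r) q w = r + q / w := by
  have hset : {b | q < proposedRanking r b w} = Set.Ioi (r + q / w) := by
    ext b
    have hqw : ¬ q / w < 0 := (div_nonneg hq hw.le).not_gt
    rw [Set.mem_ofPred_eq, Set.mem_Ioi, proposedRanking, ← div_lt_iff₀ hw, lt_max_iff,
      or_iff_left hqw, lt_sub_iff_add_lt']
  rw [price, hset, csInf_Ioi]

lemma price_standardRanking (hq : 0 ≤ q) (hw : 0 < w) :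
    price (standardRanking r) q w = max r (q / w) := by
  have hmem (b : ℝ) : q < standardRanking r b w ↔ r ≤ b ∧ q / w < b := by
    rw [div_lt_iff₀ hw, standardRanking]
    split_ifs with h <;> simp [h, hq]
  rw [price]
  rcases lt_or_ge (q / w) r with h | h
  · have hset : {b | q < standardRanking r b w} = Set.Ici r :=
      Set.ext fun b => (hmem b).trans ⟨fun hb => hb.1, fun hb => ⟨hb, h.trans_le hb⟩⟩
    rw [hset, csInf_Ici, max_eq_left h.le]
  · have hset : {b | q < standardRanking r b w} = Set.Ioi (q / w) :=
      Set.ext fun b => (hmem b).trans ⟨fun hb => hb.2, fun hb => ⟨h.trans hb.le, hb⟩⟩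
    rw [hset, csInf_Ioi, max_eq_right h]

end Price

/-- The ranking function has nonnegative scores, and its prices have the reserve price `r`. -/
structure HasReservePrice (y : ℝ → ℝ → ℝ) (r : ℝ) : Prop where
  nonneg : ∀ {b w : ℝ}, 0 < w → 0 ≤ y b w
  price_zero : ∀ {w : ℝ}, 0 < w → price y 0 w = r
  le_price : ∀ {q w : ℝ}, 0 ≤ q → 0 < w → r ≤ price y q w

lemma proposedRanking_nonneg {r b w : ℝ} (hw : 0 ≤ w) : 0 ≤ proposedRanking r b w :=
  mul_nonneg (le_max_right _ _) hw

lemma hasReservePrice_proposedRanking (r : ℝ) : HasReservePrice (proposedRanking r) r where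
  nonneg hw := proposedRanking_nonneg hw.le
  price_zero hw := by rw [price_proposedRanking le_rfl hw, zero_div, add_zero]
  le_price hq hw := by
    rw [price_proposedRanking hq hw]
    exact le_add_of_nonneg_right (div_nonneg hq hw.le)

lemma hasReservePrice_standardRanking {r : ℝ} (hr : 0 ≤ r) :
    HasReservePrice (standardRanking r) r where
  nonneg hw := by
    unfold standardRanking
    split_ifs with h
    · exact mul_nonneg (hr.trans h) hw.le
    · exact le_rfl
  price_zero hw := by rw [price_standardRanking le_rfl hw, zero_div, max_eq_left hr]
  le_price hq hw := by
    rw [price_standardRanking hq hw]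
    exact le_max_left _ _

namespace Outcome

variable {n m : ℕ} {s : Fin m → ℝ} {y : ℝ → ℝ → ℝ} {r : ℝ} {o : Outcome n}

section Relevances

variable {w : Fin n → ℝ}

lemma nextScore_nonneg (hy : HasReservePrice y r) (hw : ∀ i, 0 < w i) (k : ℕ) :
    0 ≤ o.nextScore y w k := by
  unfold nextScore
  split_ifs
  · exact hy.nonneg (hw _)
  · exact le_rfl

lemma nextScore_eq_zero (hy : HasReservePrice y r) (hw : ∀ i, 0 < w i) (ho : o.IsSorted y w)
    {i : Fin n} (hi : y (o.bid i) (w i) = 0) : o.nextScore y w (o.rank i) = 0 := by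
  refine le_antisymm ?_ (nextScore_nonneg hy hw _)
  unfold nextScore
  split_ifs with h
  · rw [← hi]
    exact ho _ _ (by simp [Fin.lt_def])
  · exact le_rfl

lemma le_priceAt (hy : HasReservePrice y r) (hw : ∀ i, 0 < w i) (k : ℕ) (i : Fin n) :
    r ≤ o.priceAt y w k (w i) :=
  hy.le_price (nextScore_nonneg hy hw k) (hw i)

lemma priceAt_of_score_eq_zero (hy : HasReservePrice y r) (hw : ∀ i, 0 < w i)
    (ho : o.IsSorted y w) {i : Fin n} (hi : y (o.bid i) (w i) = 0) (j : Fin n) :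
    o.priceAt y w (o.rank i) (w j) = r := by
  rw [priceAt, nextScore_eq_zero hy hw ho hi, hy.price_zero (hw j)]

lemma priceAt_proposedRanking_mul (hw : ∀ i, 0 < w i) (k : ℕ) (i : Fin n) :
    o.priceAt (proposedRanking r) w k (w i) * w i =
      r * w i + o.nextScore (proposedRanking r) w k := by
  rw [priceAt, price_proposedRanking
      (nextScore_nonneg (hasReservePrice_proposedRanking r) hw k) (hw i),
    add_mul, div_mul_cancel₀ _ (hw i).ne']

lemma priceAt_standardRanking_mul (hr : 0 ≤ r) (hw : ∀ i, 0 < w i) (k : ℕ) (i : Fin n) :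
    o.priceAt (standardRanking r) w k (w i) * w i =
      max (r * w i) (o.nextScore (standardRanking r) w k) := by
  rw [priceAt, price_standardRanking
      (nextScore_nonneg (hasReservePrice_standardRanking hr) hw k) (hw i),
    max_mul_of_nonneg _ _ (hw i).le, div_mul_cancel₀ _ (hw i).ne']

lemma alloc_of_pos {i : Fin n} (hi : 0 < y (o.bid i) (w i)) :
    o.alloc y s w i = slotEffect s (o.rank i) :=
  if_pos hi

lemma alloc_of_eq_zero {i : Fin n} (hi : y (o.bid i) (w i) = 0) : o.alloc y s w i = 0 :=
  if_neg hi.not_gt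

lemma alloc_nonneg (hS : Antitone (slotEffect s)) (i : Fin n) : 0 ≤ o.alloc y s w i := by
  unfold alloc
  split_ifs
  · exact slotEffect_nonneg hS _
  · exact le_rfl

lemma alloc_le (hS : Antitone (slotEffect s)) (i : Fin n) :
    o.alloc y s w i ≤ slotEffect s 0 := by
  unfold alloc
  split_ifs
  · exact hS (Nat.zero_le _)
  · exact slotEffect_nonneg hS _

lemma payment_nonneg (hy : HasReservePrice y r) (hr : 0 ≤ r) (hS : Antitone (slotEffect s))
    (hw : ∀ i, 0 < w i) (i : Fin n) :
    0 ≤ o.priceAt y w (o.rank i) (w i) * w i * o.alloc y s w i :=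
  mul_nonneg (mul_nonneg (hr.trans (le_priceAt hy hw _ i)) (hw i).le) (alloc_nonneg hS i)

end Relevances

/-- The utility per impression of advertiser `i`: the number of clicks times the surplus per
click. -/
def utility (y : ℝ → ℝ → ℝ) (s : Fin m → ℝ) (p : Types n) (o : Outcome n) (i : Fin n) : ℝ :=
  (p.1 i - o.priceAt y p.2 (o.rank i) (p.2 i)) * p.2 i * o.alloc y s p.2 i

variable {p : Types n}

namespace IsSNE

lemma mul_slotEffect_le_utility (ho : o.IsSNE y s p) (hw : ∀ i, 0 < p.2 i) (i : Fin n) (k : ℕ) :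
    (p.1 i - o.priceAt y p.2 k (p.2 i)) * p.2 i * slotEffect s k ≤ o.utility y s p i := by
  rw [utility, mul_right_comm, mul_right_comm _ (p.2 i)]
  exact mul_le_mul_of_nonneg_right (ho.2 i k) (hw i).le

/-- Not being displayed is an option. -/
lemma utility_nonneg (ho : o.IsSNE y s p) (hw : ∀ i, 0 < p.2 i) (i : Fin n) :
    0 ≤ o.utility y s p i := by
  simpa only [slotEffect_of_le le_rfl, mul_zero] using ho.mul_slotEffect_le_utility hw i m

lemma alloc_eq_zero (ho : o.IsSNE y s p) (hy : HasReservePrice y r)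
    (hS : Antitone (slotEffect s)) (hw : ∀ i, 0 < p.2 i) {i : Fin n} (hi : p.1 i < r) :
    o.alloc y s p.2 i = 0 := by
  have hneg : (p.1 i - o.priceAt y p.2 (o.rank i) (p.2 i)) * p.2 i < 0 :=
    mul_neg_of_neg_of_pos (sub_neg.mpr (hi.trans_le (le_priceAt hy hw _ i))) (hw i)
  exact le_antisymm (nonpos_of_mul_nonneg_right (ho.utility_nonneg hw i) hneg) (alloc_nonneg hS i)

lemma alloc_eq_slotEffect (ho : o.IsSNE y s p) (hy : HasReservePrice y r)
    (hS : Antitone (slotEffect s)) (hw : ∀ i, 0 < p.2 i) {i : Fin n} (hi : r < p.1 i) :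
    o.alloc y s p.2 i = slotEffect s (o.rank i) := by
  rcases (hy.nonneg (hw i)).eq_or_lt' with h0 | hpos
  · have h := ho.2 i (o.rank i)
    rw [alloc_of_eq_zero h0, mul_zero, priceAt_of_score_eq_zero hy hw ho.1 h0] at h
    rw [alloc_of_eq_zero h0]
    exact le_antisymm (slotEffect_nonneg hS _)
      (nonpos_of_mul_nonpos_right h (sub_pos.mpr hi))
  · exact alloc_of_pos hpos

lemma le_of_slotEffect_lt (ho : o.IsSNE y s p) (hy : HasReservePrice y r)
    (hS : Antitone (slotEffect s)) (hw : ∀ i, 0 < p.2 i) {i j : Fin n}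
    (hij : slotEffect s (o.rank j) < slotEffect s (o.rank i)) (hj : r < p.1 j) :
    r ≤ p.1 i := by
  by_contra! hi
  have hpos : 0 < slotEffect s (o.rank i) := (slotEffect_nonneg hS _).trans_lt hij
  have h0 : y (o.bid i) (p.2 i) = 0 := by
    refine ((hy.nonneg (hw i)).eq_or_lt').resolve_right fun h => hpos.ne' ?_
    rw [← alloc_of_pos h, ho.alloc_eq_zero hy hS hw hi]
  have henvy := ho.2 j (o.rank i)
  rw [priceAt_of_score_eq_zero hy hw ho.1 h0, ho.alloc_eq_slotEffect hy hS hw hj] at henvy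
  have hprice := mul_le_mul_of_nonneg_right
    (sub_le_sub_left (le_priceAt (o := o) hy hw (o.rank j) j) (p.1 j))
    (slotEffect_nonneg hS (o.rank j))
  exact hij.not_ge (le_of_mul_le_mul_left (henvy.trans hprice) (sub_pos.mpr hj))

lemma standard_order (ho : o.IsSNE (standardRanking r) s p) (hr : 0 ≤ r)
    (hS : Antitone (slotEffect s)) (hw : ∀ i, 0 < p.2 i) {i j : Fin n}
    (hij : slotEffect s (o.rank j) < slotEffect s (o.rank i)) (hi : r < p.1 i) (hj : r < p.1 j)
    (hwij : p.2 i ≤ p.2 j) : p.1 j * p.2 j ≤ p.1 i * p.2 i := by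
  have hy := hasReservePrice_standardRanking hr
  have henvy (k l : Fin n) := ho.mul_slotEffect_le_utility hw k (o.rank l)
  simp only [utility, sub_mul (p.1 _), priceAt_standardRanking_mul hr hw] at henvy
  have hi' := henvy i j
  have hj' := henvy j i
  rw [ho.alloc_eq_slotEffect hy hS hw hi] at hi'
  rw [ho.alloc_eq_slotEffect hy hS hw hj] at hj'
  have hSj := slotEffect_nonneg hS (o.rank j)
  set a := slotEffect s (o.rank i)
  set b := slotEffect s (o.rank j)
  set q := o.nextScore (standardRanking r) p.2 (o.rank i)
  set q' := o.nextScore (standardRanking r) p.2 (o.rank j)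
  have hrw : r * p.2 i ≤ r * p.2 j := mul_le_mul_of_nonneg_left hwij hr
  have hq : r * p.2 j < q := by
    by_contra! hq
    rw [max_eq_left hq, ← sub_mul] at hj'
    have hmax : p.1 j * p.2 j - max (r * p.2 j) q' ≤ (p.1 j - r) * p.2 j := by
      linarith [le_max_left (r * p.2 j) q']
    exact hij.not_ge (le_of_mul_le_mul_left (hj'.trans (mul_le_mul_of_nonneg_right hmax hSj))
      (mul_pos (sub_pos.mpr hj) (hw j)))
  rw [max_eq_right hq.le] at hj'
  rw [max_eq_right (hrw.trans hq.le)] at hi'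
  have hq' : b * max (r * p.2 i) q' ≤ b * max (r * p.2 j) q' :=
    mul_le_mul_of_nonneg_left (max_le_max hrw le_rfl) hSj
  refine le_of_mul_le_mul_right ?_ (sub_pos.mpr hij)
  linarith

end IsSNE

end Outcome

/-! ### The proposed ranking and its net values -/

/-- The value per impression net of the reserve price, `(θ_i - r)⁺ w_i`. Under the proposed ranking
it is the score of a truthful bid. -/
def netValue {n : ℕ} (r : ℝ) (p : Types n) (i : Fin n) : ℝ := proposedRanking r (p.1 i) (p.2 i)

section NetValue

variable {n : ℕ} {r : ℝ} {p : Types n} {i : Fin n}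

lemma netValue_of_le (hi : p.1 i ≤ r) : netValue r p i = 0 := by
  rw [netValue, proposedRanking, max_eq_right (sub_nonpos.mpr hi), zero_mul]

lemma netValue_of_lt (hi : r < p.1 i) : netValue r p i = (p.1 i - r) * p.2 i := by
  rw [netValue, proposedRanking, max_eq_left (sub_nonneg.mpr hi.le)]

lemma netValue_nonneg (hw : ∀ i, 0 < p.2 i) (i : Fin n) : 0 ≤ netValue r p i :=
  proposedRanking_nonneg (hw i).le

lemma netValue_pos_iff (hw : ∀ i, 0 < p.2 i) : 0 < netValue r p i ↔ r < p.1 i := by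
  refine ⟨fun h => not_le.mp fun hi => h.ne' (netValue_of_le hi), fun hi => ?_⟩
  rw [netValue_of_lt hi]
  exact mul_pos (sub_pos.mpr hi) (hw i)

end NetValue

namespace Outcome

variable {n m : ℕ} {s : Fin m → ℝ} {r : ℝ} {p : Types n} {o : Outcome n}

namespace IsSNE

lemma nextScore_mul_slotEffect_eq_zero (ho : o.IsSNE (proposedRanking r) s p)
    (hS : Antitone (slotEffect s)) (hw : ∀ i, 0 < p.2 i) {i : Fin n} (hi : p.1 i ≤ r) :
    o.nextScore (proposedRanking r) p.2 (o.rank i) * slotEffect s (o.rank i) = 0 := by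
  have hy := hasReservePrice_proposedRanking r
  rcases (hy.nonneg (b := o.bid i) (hw i)).eq_or_lt' with h0 | hpos
  · rw [nextScore_eq_zero hy hw ho.1 h0, zero_mul]
  · have hu := ho.utility_nonneg hw i
    rw [utility, sub_mul, priceAt_proposedRanking_mul hw, alloc_of_pos hpos] at hu
    have hS_nonneg := slotEffect_nonneg hS (o.rank i)
    have hle : (p.1 i - r) * p.2 i * slotEffect s (o.rank i) ≤ 0 :=
      mul_nonpos_of_nonpos_of_nonneg
        (mul_nonpos_of_nonpos_of_nonneg (sub_nonpos.mpr hi) (hw i).le) hS_nonneg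
    refine le_antisymm ?_ (mul_nonneg (nextScore_nonneg hy hw _) hS_nonneg)
    linarith

lemma utility_proposedRanking (ho : o.IsSNE (proposedRanking r) s p)
    (hS : Antitone (slotEffect s)) (hw : ∀ i, 0 < p.2 i) (i : Fin n) :
    o.utility (proposedRanking r) s p i =
      (netValue r p i - o.nextScore (proposedRanking r) p.2 (o.rank i)) *
        slotEffect s (o.rank i) := by
  have hy := hasReservePrice_proposedRanking r
  rcases lt_or_ge r (p.1 i) with hi | hi
  · rw [utility, sub_mul, priceAt_proposedRanking_mul hw, ho.alloc_eq_slotEffect hy hS hw hi,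
      netValue_of_lt hi]
    ring
  · rw [netValue_of_le hi, sub_mul, ho.nextScore_mul_slotEffect_eq_zero hS hw hi, zero_mul,
      sub_zero]
    refine le_antisymm ?_ (ho.utility_nonneg hw i)
    exact mul_nonpos_of_nonpos_of_nonneg (mul_nonpos_of_nonpos_of_nonneg
      (sub_nonpos.mpr (hi.trans (le_priceAt hy hw _ i))) (hw i).le) (alloc_nonneg hS i)

lemma isEnvyFree (ho : o.IsSNE (proposedRanking r) s p) (hS : Antitone (slotEffect s))
    (hw : ∀ i, 0 < p.2 i) :
    IsEnvyFree (slotEffect s) (o.nextScore (proposedRanking r) p.2) (netValue r p) o.rank := by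
  intro i k
  rw [← ho.utility_proposedRanking hS hw i]
  rcases lt_or_ge r (p.1 i) with hi | hi
  · convert ho.mul_slotEffect_le_utility hw i k using 2
    rw [sub_mul, priceAt_proposedRanking_mul hw, netValue_of_lt hi]
    ring
  · rw [netValue_of_le hi, zero_sub]
    exact (mul_nonpos_of_nonpos_of_nonneg (neg_nonpos.mpr
      (nextScore_nonneg (hasReservePrice_proposedRanking r) hw k))
      (slotEffect_nonneg hS k)).trans (ho.utility_nonneg hw i)

end IsSNE

end Outcome

/-! ### The law of a single value -/

/-- The inverse hazard rate `(1 - F(t)) / f(t)`. -/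
def inverseHazard (f : ℝ → ℝ) (t : ℝ) : ℝ := (1 - valueCDF f t) / f t

lemma virtualValue_eq (f : ℝ → ℝ) (t : ℝ) : virtualValue f t = t - inverseHazard f t := rfl

lemma valueCDF_mono (f : ℝ → ℝ) : Monotone (valueCDF f) :=
  (ProbabilityTheory.cdf (valueLaw f)).mono

lemma valueCDF_le_one (f : ℝ → ℝ) (t : ℝ) : valueCDF f t ≤ 1 := ProbabilityTheory.cdf_le_one _ _

lemma valueLaw_singleton (f : ℝ → ℝ) (t : ℝ) : valueLaw f {t} = 0 :=
  withDensity_absolutelyContinuous _ _ (measure_singleton t)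

lemma ordConnected_valueRange (f : ℝ → ℝ) : (valueRange f).OrdConnected :=
  ⟨fun _ ht _ hu _ hv => ⟨ht.1.trans_le hv.1, (valueCDF_mono f hv.2).trans_lt hu.2⟩⟩

lemma isOpen_valueRange (f : ℝ → ℝ) : IsOpen (valueRange f) := by
  refine isOpen_iff_mem_nhds.mpr fun t ht => ?_
  have hcont : ContinuousWithinAt (valueCDF f) (Set.Ioi t) t :=
    ((ProbabilityTheory.cdf (valueLaw f)).right_continuous t).mono Set.Ioi_subset_Ici_self
  obtain ⟨u, hu, htu⟩ :=
    ((hcont.eventually (gt_mem_nhds ht.2)).and self_mem_nhdsWithin).exists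
  exact Filter.mem_of_superset (Ioo_mem_nhds ht.1 htu)
    fun v hv => ⟨hv.1, (valueCDF_mono f hv.2.le).trans_lt hu⟩

lemma lintegral_lintegral_Ioo {μ : Measure ℝ} [SFinite μ] (r : ℝ) {H : ℝ → ENNReal}
    (hH : Measurable H) :
    ∫⁻ t, (∫⁻ z in Set.Ioo r t, H z) ∂μ = ∫⁻ z in Set.Ioi r, H z * μ (Set.Ioi z) := by
  set A : Set (ℝ × ℝ) := {x | r < x.2 ∧ x.2 < x.1}
  have hA : MeasurableSet A := (measurableSet_lt measurable_const measurable_snd).inter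
    (measurableSet_lt measurable_snd measurable_fst)
  have hmeas : Measurable fun x : ℝ × ℝ => A.indicator (fun x => H x.2) x :=
    (hH.comp measurable_snd).indicator hA
  calc ∫⁻ t, (∫⁻ z in Set.Ioo r t, H z) ∂μ
      = ∫⁻ t, (∫⁻ z, A.indicator (fun x => H x.2) (t, z)) ∂μ :=
        lintegral_congr fun t => (lintegral_indicator measurableSet_Ioo _).symm
    _ = ∫⁻ z, ∫⁻ t, A.indicator (fun x => H x.2) (t, z) ∂μ :=
        lintegral_lintegral_swap hmeas.aemeasurable
    _ = ∫⁻ z, (Set.Ioi r).indicator (fun z => H z * μ (Set.Ioi z)) z := by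
        refine lintegral_congr fun z => ?_
        by_cases hz : r < z
        · rw [Set.indicator_of_mem (Set.mem_Ioi.mpr hz), ← setLIntegral_const,
            ← lintegral_indicator measurableSet_Ioi]
          simp [A, Set.indicator, hz]
        · simp [A, Set.indicator, hz]
    _ = ∫⁻ z in Set.Ioi r, H z * μ (Set.Ioi z) := lintegral_indicator measurableSet_Ioi _

namespace IsRegularDensity

variable {f : ℝ → ℝ}

lemma valueLaw_Iic (hf : IsRegularDensity f) (t : ℝ) :
    valueLaw f (Set.Iic t) = ENNReal.ofReal (valueCDF f t) := by
  have := hf.isProbabilityMeasure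
  rw [valueCDF, ProbabilityTheory.cdf_eq_real, ofReal_measureReal]

lemma valueLaw_Ioi (hf : IsRegularDensity f) (t : ℝ) :
    valueLaw f (Set.Ioi t) = ENNReal.ofReal (1 - valueCDF f t) := by
  have := hf.isProbabilityMeasure
  have h0 : 0 ≤ valueCDF f t := ProbabilityTheory.cdf_nonneg _ _
  rw [← Set.compl_Iic, prob_compl_eq_one_sub measurableSet_Iic, hf.valueLaw_Iic,
    ENNReal.ofReal_sub _ h0, ENNReal.ofReal_one]

lemma valueLaw_Ici_eq_zero (hf : IsRegularDensity f) {t : ℝ} (ht : valueCDF f t = 1) :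
    valueLaw f (Set.Ici t) = 0 := by
  rw [← Set.Ioi_union_left]
  refine measure_union_null ?_ (valueLaw_singleton f t)
  rw [hf.valueLaw_Ioi, ht, sub_self, ENNReal.ofReal_zero]

lemma valueLaw_Iic_zero (hf : IsRegularDensity f) : valueLaw f (Set.Iic 0) = 0 := by
  rw [hf.valueLaw_Iic, hf.cdf_zero, ENNReal.ofReal_zero]

lemma ae_pos (hf : IsRegularDensity f) : ∀ᵐ t ∂valueLaw f, 0 < t := by
  simpa [ae_iff, Set.Iic_def] using hf.valueLaw_Iic_zero

lemma ae_valueCDF_lt_one (hf : IsRegularDensity f) : ∀ᵐ t ∂valueLaw f, valueCDF f t < 1 := by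
  have eq_one {t : ℝ} (ht : ¬ valueCDF f t < 1) : valueCDF f t = 1 :=
    le_antisymm (valueCDF_le_one f t) (not_lt.mp ht)
  refine measure_null_of_locally_null _ fun t ht => ?_
  by_cases hmin : ∃ u < t, valueCDF f u = 1
  · obtain ⟨u, hut, hu⟩ := hmin
    exact ⟨Set.Ici u, mem_nhdsWithin_of_mem_nhds (Ici_mem_nhds hut), hf.valueLaw_Ici_eq_zero hu⟩
  · push Not at hmin
    refine ⟨Set.Ici t, Filter.mem_of_superset self_mem_nhdsWithin fun u hu => ?_,
      hf.valueLaw_Ici_eq_zero (eq_one ht)⟩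
    exact not_lt.mp fun hut => hmin u hut (eq_one hu)

lemma pos (hf : IsRegularDensity f) {t : ℝ} (ht : t ∈ valueRange f) : 0 < f t := by
  refine (hf.nonneg t).lt_of_ne fun h0 => (hf.support_at_zero t ht.1).not_ge ?_
  have hzero : ∀ u ∈ Set.Ioc 0 t, f u = 0 := by
    intro u hu
    have hu1 : valueCDF f u < 1 := (valueCDF_mono f hu.2).trans_lt ht.2
    have hhazard : f u / (1 - valueCDF f u) ≤ f t / (1 - valueCDF f t) :=
      hf.hazard_monotone ⟨hu.1, hu1⟩ ht hu.2
    rw [← h0, zero_div, div_le_iff₀ (sub_pos.mpr hu1), zero_mul] at hhazard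
    exact le_antisymm hhazard (hf.nonneg u)
  have hIoc : valueLaw f (Set.Ioc 0 t) = 0 := by
    rw [valueLaw, withDensity_apply _ measurableSet_Ioc]
    exact (setLIntegral_congr_fun measurableSet_Ioc
      fun u hu => by rw [hzero u hu, ENNReal.ofReal_zero]).trans lintegral_zero
  rw [← ENNReal.ofReal_eq_zero, ← hf.valueLaw_Iic, ← Set.Iic_union_Ioc_eq_Iic ht.1.le]
  exact measure_union_null hf.valueLaw_Iic_zero hIoc

lemma inverseHazard_nonneg (hf : IsRegularDensity f) (t : ℝ) : 0 ≤ inverseHazard f t :=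
  div_nonneg (sub_nonneg.mpr (valueCDF_le_one f t)) (hf.nonneg t)

lemma inverseHazard_antitoneOn (hf : IsRegularDensity f) :
    AntitoneOn (inverseHazard f) (Set.Ioi 0) := by
  intro t ht u hu htu
  rcases (valueCDF_le_one f u).eq_or_lt with hu1 | hu1
  · rw [inverseHazard, hu1, sub_self, zero_div]
    exact hf.inverseHazard_nonneg t
  · have ht' : t ∈ valueRange f := ⟨ht, (valueCDF_mono f htu).trans_lt hu1⟩
    have h := inv_anti₀ (div_pos (hf.pos ht') (sub_pos.mpr ht'.2))
      (hf.hazard_monotone ht' ⟨hu, hu1⟩ htu)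
    rwa [inv_div, inv_div] at h

lemma virtualValue_strictMonoOn (hf : IsRegularDensity f) :
    StrictMonoOn (virtualValue f) (Set.Ioi 0) := by
  intro t ht u hu htu
  rw [virtualValue_eq, virtualValue_eq]
  linarith [hf.inverseHazard_antitoneOn ht hu htu.le]

lemma differentiableAt_virtualValue (hf : IsRegularDensity f) {t : ℝ} (ht : t ∈ valueRange f) :
    DifferentiableAt ℝ (virtualValue f) t :=
  hf.differentiable.differentiableAt ((isOpen_valueRange f).mem_nhds ht)

lemma one_le_deriv_virtualValue (hf : IsRegularDensity f) {t : ℝ} (ht : t ∈ valueRange f) :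
    1 ≤ deriv (virtualValue f) t := by
  have hmono : MonotoneOn (fun u => virtualValue f u - u) (valueRange f) := fun u hu v hv huv => by
    simp only [virtualValue_eq]
    linarith [hf.inverseHazard_antitoneOn hu.1 hv.1 huv]
  have h := hmono.derivWithin_nonneg (x := t)
  rw [derivWithin_of_isOpen (isOpen_valueRange f) ht,
    deriv_fun_sub (hf.differentiableAt_virtualValue ht) differentiableAt_fun_id, deriv_id''] at h
  linarith

lemma monotoneOn_virtualValue_div (hf : IsRegularDensity f) {r : ℝ}
    (hr : ∀ t ∈ Set.Ioi r ∩ valueRange f,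
      r ≤ t - virtualValue f t / deriv (virtualValue f) t) :
    MonotoneOn (fun t => virtualValue f t / (t - r)) (Set.Ioi r ∩ valueRange f) := by
  have hderiv : ∀ t ∈ Set.Ioi r ∩ valueRange f, HasDerivAt (fun t => virtualValue f t / (t - r))
      ((deriv (virtualValue f) t * (t - r) - virtualValue f t * 1) / (t - r) ^ 2) t := fun t ht =>
    (hf.differentiableAt_virtualValue ht.2).hasDerivAt.div ((hasDerivAt_id t).sub_const r)
      (sub_pos.mpr ht.1).ne'
  refine monotoneOn_of_deriv_nonneg (Set.ordConnected_Ioi.inter (ordConnected_valueRange f)).convex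
    (fun t ht => (hderiv t ht).continuousAt.continuousWithinAt)
    (fun t ht => (hderiv t (interior_subset ht)).differentiableAt.differentiableWithinAt)
    fun t ht => ?_
  replace ht := interior_subset ht
  rw [(hderiv t ht).deriv]
  have hφ' : 0 < deriv (virtualValue f) t :=
    zero_lt_one.trans_le (hf.one_le_deriv_virtualValue ht.2)
  have hle : virtualValue f t ≤ (t - r) * deriv (virtualValue f) t :=
    (div_le_iff₀ hφ').mp (le_sub_comm.mp (hr t ht))
  exact div_nonneg (by linarith) (sq_nonneg _)

section Comparison

variable {r a b v w : ℝ}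

lemma virtualValue_mul_le_mul (hf : IsRegularDensity f)
    (hr : MonotoneOn (fun t => virtualValue f t / (t - r)) (Set.Ioi r ∩ valueRange f))
    (ha : a ∈ Set.Ioi r ∩ valueRange f) (hb : b ∈ Set.Ioi r ∩ valueRange f) (hw : 0 < w)
    (hwv : w ≤ v) (h : (a - r) * v ≤ (b - r) * w) :
    virtualValue f a * v ≤ virtualValue f b * w := by
  have har : 0 < a - r := sub_pos.mpr ha.1
  have hbr : 0 < b - r := sub_pos.mpr hb.1
  have hab : a ≤ b := sub_le_sub_iff_right r |>.mp <|
    le_of_mul_le_mul_right ((mul_le_mul_of_nonneg_left hwv har.le).trans h) hw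
  rcases le_or_gt (virtualValue f a) 0 with hφ | hφ
  · calc virtualValue f a * v ≤ virtualValue f a * w := mul_le_mul_of_nonpos_left hwv hφ
      _ ≤ virtualValue f b * w := mul_le_mul_of_nonneg_right
          (hf.virtualValue_strictMonoOn.monotoneOn ha.2.1 hb.2.1 hab) hw.le
  · calc virtualValue f a * v = virtualValue f a / (a - r) * ((a - r) * v) := by field_simp
      _ ≤ virtualValue f a / (a - r) * ((b - r) * w) := by gcongr
      _ ≤ virtualValue f b / (b - r) * ((b - r) * w) :=
          mul_le_mul_of_nonneg_right (hr ha hb hab) (by positivity)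
      _ = virtualValue f b * w := by field_simp

lemma virtualValue_mul_lt_mul (hf : IsRegularDensity f)
    (hr : MonotoneOn (fun t => virtualValue f t / (t - r)) (Set.Ioi r ∩ valueRange f))
    (ha : a ∈ Set.Ioi r ∩ valueRange f) (hb : b ∈ Set.Ioi r ∩ valueRange f) (hw : 0 < w)
    (hwv : w ≤ v) (h : (a - r) * v < (b - r) * w) :
    virtualValue f a * v < virtualValue f b * w := by
  have har : 0 < a - r := sub_pos.mpr ha.1
  have hbr : 0 < b - r := sub_pos.mpr hb.1
  have hab : a < b := sub_lt_sub_iff_right r |>.mp <|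
    lt_of_mul_lt_mul_right ((mul_le_mul_of_nonneg_left hwv har.le).trans_lt h) hw.le
  rcases le_or_gt (virtualValue f a) 0 with hφ | hφ
  · calc virtualValue f a * v ≤ virtualValue f a * w := mul_le_mul_of_nonpos_left hwv hφ
      _ < virtualValue f b * w := mul_lt_mul_of_pos_right
          (hf.virtualValue_strictMonoOn ha.2.1 hb.2.1 hab) hw
  · calc virtualValue f a * v = virtualValue f a / (a - r) * ((a - r) * v) := by field_simp
      _ < virtualValue f a / (a - r) * ((b - r) * w) := by gcongr
      _ ≤ virtualValue f b / (b - r) * ((b - r) * w) :=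
          mul_le_mul_of_nonneg_right (hr ha hb hab.le) (by positivity)
      _ = virtualValue f b * w := by field_simp

end Comparison

lemma valueLaw_Ioo_pos (hf : IsRegularDensity f) {a b : ℝ} (ha : 0 ≤ a) (hab : a < b)
    (hb : valueCDF f b < 1) : 0 < valueLaw f (Set.Ioo a b) := by
  rw [valueLaw, withDensity_apply _ measurableSet_Ioo,
    setLIntegral_pos_iff hf.measurable.ennreal_ofReal]
  have hsupp : Set.Ioo a b ⊆ Function.support fun t => ENNReal.ofReal (f t) := fun t ht =>
    (ENNReal.ofReal_pos.mpr
      (hf.pos ⟨ha.trans_lt ht.1, (valueCDF_mono f ht.2.le).trans_lt hb⟩)).ne'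
  rw [Set.inter_eq_right.mpr hsupp, Real.volume_Ioo]
  exact ENNReal.ofReal_pos.mpr (sub_pos.mpr hab)

lemma density_mul_inverseHazard (hf : IsRegularDensity f) {t : ℝ} (ht : 0 < t) :
    f t * inverseHazard f t = 1 - valueCDF f t := by
  rcases (valueCDF_le_one f t).eq_or_lt with h1 | h1
  · rw [inverseHazard, h1, sub_self, zero_div, mul_zero]
  · exact mul_div_cancel₀ _ (hf.pos ⟨ht, h1⟩).ne'

lemma measurable_inverseHazard (hf : IsRegularDensity f) : Measurable (inverseHazard f) :=
  (measurable_const.sub (valueCDF_mono f).measurable).div hf.measurable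

lemma lintegral_lintegral_Ioo_eq (hf : IsRegularDensity f) {r : ℝ} (hr : 0 ≤ r)
    {H : ℝ → ENNReal} (hH : Measurable H) :
    ∫⁻ t, (∫⁻ z in Set.Ioo r t, H z) ∂valueLaw f =
      ∫⁻ t in Set.Ioi r, H t * ENNReal.ofReal (inverseHazard f t) ∂valueLaw f := by
  have := hf.isProbabilityMeasure
  rw [lintegral_lintegral_Ioo r hH]
  refine Eq.trans ?_ (setLIntegral_withDensity_eq_setLIntegral_mul _
    hf.measurable.ennreal_ofReal (hH.mul hf.measurable_inverseHazard.ennreal_ofReal)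
    measurableSet_Ioi).symm
  refine setLIntegral_congr_fun measurableSet_Ioi fun t ht => ?_
  simp only [Pi.mul_apply]
  rw [mul_left_comm, ← ENNReal.ofReal_mul (hf.nonneg t),
    hf.density_mul_inverseHazard (hr.trans_lt ht), hf.valueLaw_Ioi]

lemma lintegral_inverseHazard_le (hf : IsRegularDensity f) {r : ℝ} (hr : 0 < r) :
    ∫⁻ t in Set.Ioi r, ENNReal.ofReal (inverseHazard f t) ∂valueLaw f ≤
      ENNReal.ofReal (inverseHazard f r) := by
  have := hf.isProbabilityMeasure
  calc ∫⁻ t in Set.Ioi r, ENNReal.ofReal (inverseHazard f t) ∂valueLaw f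
      ≤ ∫⁻ _ in Set.Ioi r, ENNReal.ofReal (inverseHazard f r) ∂valueLaw f :=
        setLIntegral_mono measurable_const fun t ht => ENNReal.ofReal_le_ofReal
          (hf.inverseHazard_antitoneOn hr (hr.trans ht) (le_of_lt ht))
    _ ≤ ∫⁻ _, ENNReal.ofReal (inverseHazard f r) ∂valueLaw f := setLIntegral_le_lintegral _ _
    _ = ENNReal.ofReal (inverseHazard f r) := by rw [lintegral_const, measure_univ, mul_one]

lemma integrable_id (hf : IsRegularDensity f) : Integrable (fun t => t) (valueLaw f) := by
  have := hf.isProbabilityMeasure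
  refine ⟨measurable_id.aestronglyMeasurable, ?_⟩
  rw [hasFiniteIntegral_iff_ofReal (hf.ae_pos.mono fun t ht => ht.le)]
  calc ∫⁻ t, ENNReal.ofReal t ∂valueLaw f
      ≤ ∫⁻ t, (1 + ∫⁻ _ in Set.Ioo 1 t, 1) ∂valueLaw f := by
        refine lintegral_mono fun t => ?_
        rw [setLIntegral_one, Real.volume_Ioo, ← ENNReal.ofReal_one]
        simpa only [add_sub_cancel] using ENNReal.ofReal_add_le (p := 1) (q := t - 1)
    _ = 1 + ∫⁻ t in Set.Ioi 1, ENNReal.ofReal (inverseHazard f t) ∂valueLaw f := by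
        have h := hf.lintegral_lintegral_Ioo_eq zero_le_one (H := fun _ => 1) measurable_const
        simp only [one_mul] at h
        rw [lintegral_add_left measurable_const, lintegral_const, measure_univ, mul_one, h]
    _ < ⊤ := ENNReal.add_lt_top.mpr ⟨ENNReal.one_lt_top,
        (hf.lintegral_inverseHazard_le zero_lt_one).trans_lt ENNReal.ofReal_lt_top⟩

end IsRegularDensity

/-! ### Resampling one value -/

/-- The types with the value of advertiser `i` replaced by `t`. -/
def replaceValue {n : ℕ} (i : Fin n) (t : ℝ) (p : Types n) : Types n :=
  (Function.update p.1 i t, p.2)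

/-- The clicks that the slot effects `s` give advertiser `i` at the value `t` if the advertisers are
sorted by their net values. -/
def entitledClicks {n m : ℕ} (s : Fin m → ℝ) (r : ℝ) (i : Fin n) (p : Types n) (t : ℝ) : ℝ :=
  p.2 i * slotEffect s (numAbove (netValue r p) i ((t - r) * p.2 i))

section Resampling

variable {n m : ℕ} {f : ℝ → ℝ} {ν : Measure (Fin n → ℝ)}

lemma entitledClicks_replaceValue (s : Fin m → ℝ) (r : ℝ) (i : Fin n) (t : ℝ) (p : Types n) :
    entitledClicks s r i (replaceValue i t p) = entitledClicks s r i p := by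
  have hnum (z : ℝ) :
      numAbove (netValue r (replaceValue i t p)) i z = numAbove (netValue r p) i z := by
    refine congrArg Finset.card (Finset.filter_congr fun j _ => and_congr_right fun hj => ?_)
    simp only [netValue, replaceValue, Function.update_of_ne hj]
  funext u
  rw [entitledClicks, hnum]
  rfl

lemma measurable_value (i : Fin n) : Measurable fun p : Types n => p.1 i :=
  (measurable_pi_apply i).comp measurable_fst

lemma measurable_relevance (i : Fin n) : Measurable fun p : Types n => p.2 i :=
  (measurable_pi_apply i).comp measurable_snd

lemma measurable_proposedRanking (r : ℝ) : Measurable (Function.uncurry (proposedRanking r)) :=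
  ((measurable_fst.sub_const r).max measurable_const).mul measurable_snd

lemma measurable_netValue (r : ℝ) (i : Fin n) : Measurable fun p : Types n => netValue r p i :=
  (measurable_proposedRanking r).comp ((measurable_value i).prodMk (measurable_relevance i))

lemma measurable_entitledClicks (s : Fin m → ℝ) (r : ℝ) (i : Fin n) :
    Measurable fun x : Types n × ℝ => entitledClicks s r i x.1 x.2 := by
  have hw : Measurable fun x : Types n × ℝ => x.1.2 i :=
    (measurable_relevance i).comp measurable_fst
  have hnum : Measurable fun x : Types n × ℝ =>
      numAbove (netValue r x.1) i ((x.2 - r) * x.1.2 i) := by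
    simp only [numAbove, Finset.card_filter]
    refine Finset.measurable_sum _ fun j _ =>
      Measurable.ite (.inter (.const _) ?_) measurable_const measurable_const
    exact measurableSet_lt ((measurable_snd.sub_const r).mul hw)
      ((measurable_netValue r j).comp measurable_fst)
  exact hw.mul ((Measurable.of_discrete (f := slotEffect s)).comp hnum)

instance [IsProbabilityMeasure (valueLaw f)] [IsProbabilityMeasure ν] :
    IsProbabilityMeasure (typeLaw f ν) := by
  unfold typeLaw
  infer_instance

variable [IsProbabilityMeasure (valueLaw f)]

lemma ae_value [IsProbabilityMeasure ν] {q : ℝ → Prop} (h : ∀ᵐ t ∂valueLaw f, q t) :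
    ∀ᵐ p ∂typeLaw f ν, ∀ i, q (p.1 i) :=
  ae_all_iff.mpr fun i => ((measurePreserving_eval (fun _ : Fin n => valueLaw f) i).comp
    measurePreserving_fst).quasiMeasurePreserving.ae h

variable [SFinite ν]

lemma ae_relevance {q : (Fin n → ℝ) → Prop} (h : ∀ᵐ w ∂ν, q w) : ∀ᵐ p ∂typeLaw f ν, q p.2 :=
  (measurePreserving_snd (μ := Measure.pi fun _ : Fin n => valueLaw f)
    (ν := ν)).quasiMeasurePreserving.ae h

lemma lintegral_typeLaw_congr (i : Fin n) {G H : Types n → ENNReal} (hG : Measurable G)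
    (hH : Measurable H)
    (h : ∀ p, ∫⁻ t, G (replaceValue i t p) ∂valueLaw f = ∫⁻ t, H (replaceValue i t p) ∂valueLaw f) :
    ∫⁻ p, G p ∂typeLaw f ν = ∫⁻ p, H p ∂typeLaw f ν := by
  rw [typeLaw, lintegral_prod_symm' _ hG, lintegral_prod_symm' _ hH]
  refine lintegral_congr fun w => lintegral_eq_of_lmarginal_eq {i}
    (hG.comp measurable_prodMk_right) (hH.comp measurable_prodMk_right) ?_
  rw [lmarginal_singleton, lmarginal_singleton]
  exact funext fun θ => h (θ, w)

lemma ae_netValue_ne (r : ℝ) (hw : ∀ᵐ w ∂ν, ∀ i, 0 < w i) :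
    ∀ᵐ p ∂typeLaw f ν, ∀ i j, j ≠ i → r < p.1 i → netValue r p j ≠ netValue r p i := by
  simp only [ae_all_iff]
  intro i j hji
  set A : Set (Types n) := {p | (r < p.1 i ∧ 0 < p.2 i) ∧ netValue r p j = netValue r p i}
  have hA_meas : MeasurableSet A :=
    ((measurableSet_lt measurable_const (measurable_value i)).inter
      (measurableSet_lt measurable_const (measurable_relevance i))).inter
      (measurableSet_eq_fun (measurable_netValue r j) (measurable_netValue r i))
  have hA_null : typeLaw f ν A = 0 := by
    rw [← lintegral_indicator_one hA_meas, ← lintegral_zero (μ := typeLaw f ν)]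
    refine lintegral_typeLaw_congr i (measurable_one.indicator hA_meas) measurable_const
      fun p => lintegral_congr_ae ?_
    filter_upwards [measure_eq_zero_iff_ae_notMem.mp
      (valueLaw_singleton f (r + netValue r p j / p.2 i))] with t ht
    refine Set.indicator_of_notMem (fun hmem => ht ?_) _
    obtain ⟨⟨hr, hwi⟩, htie⟩ := hmem
    rw [netValue_of_lt hr] at htie
    simp only [netValue, replaceValue, Function.update_self, Function.update_of_ne hji]
      at htie hwi
    rw [Set.mem_singleton_iff, netValue, htie, mul_div_cancel_right₀ _ hwi.ne', add_sub_cancel]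
  filter_upwards [measure_eq_zero_iff_ae_notMem.mp hA_null, ae_relevance hw] with p hp hwp hi heq
  exact hp ⟨⟨hi, hwp i⟩, heq⟩

end Resampling

/-! ### The expected utilities -/

section ExpectedUtility

variable {n m : ℕ} {s : Fin m → ℝ} {f : ℝ → ℝ} {r : ℝ} {ν : Measure (Fin n → ℝ)}

lemma lintegral_lintegral_entitledClicks [SFinite ν] (hf : IsRegularDensity f) (s : Fin m → ℝ)
    (hr : 0 ≤ r) (i : Fin n) :
    ∫⁻ p, (∫⁻ t in Set.Ioo r (p.1 i), ENNReal.ofReal (entitledClicks s r i p t)) ∂typeLaw f ν =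
      ∫⁻ p, {p : Types n | r < p.1 i}.indicator (fun p => ENNReal.ofReal
        (entitledClicks s r i p (p.1 i)) * ENNReal.ofReal (inverseHazard f (p.1 i))) p
          ∂typeLaw f ν := by
  have := hf.isProbabilityMeasure
  have hE := (measurable_entitledClicks (n := n) s r i).ennreal_ofReal
  have hL : Measurable fun p : Types n =>
      ∫⁻ t in Set.Ioo r (p.1 i), ENNReal.ofReal (entitledClicks s r i p t) := by
    have hset : MeasurableSet {x : Types n × ℝ | r < x.2 ∧ x.2 < x.1.1 i} :=
      (measurableSet_lt measurable_const measurable_snd).inter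
        (measurableSet_lt measurable_snd ((measurable_value i).comp measurable_fst))
    simp_rw [← lintegral_indicator measurableSet_Ioo]
    exact (hE.indicator hset).lintegral_prod_right'
  have hR : Measurable ({p : Types n | r < p.1 i}.indicator fun p => ENNReal.ofReal
      (entitledClicks s r i p (p.1 i)) * ENNReal.ofReal (inverseHazard f (p.1 i))) :=
    ((hE.comp (measurable_id.prodMk (measurable_value i))).mul
      (hf.measurable_inverseHazard.comp (measurable_value i)).ennreal_ofReal).indicator
      (measurableSet_lt measurable_const (measurable_value i))
  refine lintegral_typeLaw_congr i hL hR fun p => ?_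
  have h := hf.lintegral_lintegral_Ioo_eq hr
    (hE.comp (measurable_const (a := p).prodMk measurable_id))
  rw [← lintegral_indicator measurableSet_Ioi] at h
  simp only [Set.indicator, Set.mem_ofPred_eq, entitledClicks_replaceValue]
  simp only [replaceValue, Function.update_self]
  exact h

namespace Outcome.IsSNE

variable {p : Types n} {o : Outcome n}

lemma utility_le_lintegral (ho : o.IsSNE (proposedRanking r) s p) (hS : Antitone (slotEffect s))
    (hw : ∀ i, 0 < p.2 i) (i : Fin n) :
    ENNReal.ofReal (o.utility (proposedRanking r) s p i) ≤
      ∫⁻ t in Set.Ioo r (p.1 i), ENNReal.ofReal (entitledClicks s r i p t) := by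
  have hle : o.utility (proposedRanking r) s p i ≤
      ∫ z in 0..netValue r p i, slotEffect s (numAbove (netValue r p) i z) := by
    rw [ho.utility_proposedRanking hS hw]
    exact (ho.isEnvyFree hS hw).utility_le_integral hS (slotEffect_nonneg hS)
      (nextScore_nonneg (hasReservePrice_proposedRanking r) hw) (netValue_nonneg hw) i
  rcases le_or_gt (p.1 i) r with hi | hi
  · rw [netValue_of_le hi, intervalIntegral.integral_same] at hle
    rw [ENNReal.ofReal_of_nonpos hle]
    exact zero_le
  have hsubst : ∫ z in 0..netValue r p i, slotEffect s (numAbove (netValue r p) i z) =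
      ∫ t in r..p.1 i, entitledClicks s r i p t := by
    set g : ℝ → ℝ := fun z => slotEffect s (numAbove (netValue r p) i z)
    change _ = ∫ t in r..p.1 i, p.2 i * g ((t - r) * p.2 i)
    rw [intervalIntegral.integral_const_mul,
      intervalIntegral.integral_comp_sub_right (fun u => g (u * p.2 i)),
      intervalIntegral.mul_integral_comp_mul_right (f := g), sub_self, zero_mul, netValue_of_lt hi]
  have hmeas : Measurable (entitledClicks s r i p) :=
    (measurable_entitledClicks s r i).comp (measurable_const.prodMk measurable_id)
  have hnonneg : ∀ᵐ t ∂volume.restrict (Set.Ioo r (p.1 i)), 0 ≤ entitledClicks s r i p t :=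
    ae_of_all _ fun t => mul_nonneg (hw i).le (slotEffect_nonneg hS _)
  rw [hsubst, intervalIntegral.integral_of_le hi.le, integral_Ioc_eq_integral_Ioo,
    integral_eq_lintegral_of_nonneg_ae hnonneg hmeas.aestronglyMeasurable] at hle
  exact (ENNReal.ofReal_le_ofReal hle).trans ENNReal.ofReal_toReal_le

lemma entitledClicks_le (ho : o.IsSNE (proposedRanking r) s p) (hS : Antitone (slotEffect s))
    (hw : ∀ i, 0 < p.2 i) {i : Fin n} (hi : r < p.1 i)
    (hties : ∀ j, j ≠ i → netValue r p j ≠ netValue r p i) :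
    entitledClicks s r i p (p.1 i) ≤ p.2 i * o.alloc (proposedRanking r) s p.2 i := by
  rw [ho.alloc_eq_slotEffect (hasReservePrice_proposedRanking r) hS hw hi, entitledClicks,
    ← netValue_of_lt hi]
  exact mul_le_mul_of_nonneg_left ((ho.isEnvyFree hS hw).slot_numAbove_le hS hties) (hw i).le

end Outcome.IsSNE

lemma lintegral_utility_le [SFinite ν] (hf : IsRegularDensity f) (hS : Antitone (slotEffect s))
    (hr : 0 ≤ r) (hw : ∀ᵐ w ∂ν, ∀ i, 0 < w i) {o : Types n → Outcome n}
    (ho : ∀ᵐ p ∂typeLaw f ν, (o p).IsSNE (proposedRanking r) s p) (i : Fin n) :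
    ∫⁻ p, ENNReal.ofReal ((o p).utility (proposedRanking r) s p i) ∂typeLaw f ν ≤
      ∫⁻ p, ENNReal.ofReal (p.2 i * (o p).alloc (proposedRanking r) s p.2 i *
        inverseHazard f (p.1 i)) ∂typeLaw f ν := by
  have := hf.isProbabilityMeasure
  have hwp : ∀ᵐ p ∂typeLaw f ν, ∀ i, 0 < p.2 i := ae_relevance hw
  calc _ ≤ ∫⁻ p, (∫⁻ t in Set.Ioo r (p.1 i), ENNReal.ofReal (entitledClicks s r i p t))
        ∂typeLaw f ν := by
        refine lintegral_mono_ae ?_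
        filter_upwards [ho, hwp] with p hop hwp
        exact hop.utility_le_lintegral hS hwp i
    _ = _ := lintegral_lintegral_entitledClicks hf s hr i
    _ ≤ _ := by
        refine lintegral_mono_ae ?_
        filter_upwards [ho, hwp, ae_netValue_ne r hw] with p hop hwp hties
        refine Set.indicator_apply_le' (fun hi => ?_) fun _ => zero_le
        rw [← ENNReal.ofReal_mul' (hf.inverseHazard_nonneg _)]
        exact ENNReal.ofReal_le_ofReal (mul_le_mul_of_nonneg_right
          (hop.entitledClicks_le hS hwp hi fun j hj => hties i j hj hi)
          (hf.inverseHazard_nonneg _))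

end ExpectedUtility

/-! ### The virtual surplus for given types -/

section Pointwise

variable {n m : ℕ} {s : Fin m → ℝ} {f : ℝ → ℝ} {r : ℝ} {p : Types n}

/-- The virtual value per impression `φ(θ_i) w_i` of the advertisers with values above the reserve
price; the other advertisers, who are not displayed in equilibrium, have weight `0`. -/
def virtualWeight (f : ℝ → ℝ) (r : ℝ) (p : Types n) (i : Fin n) : ℝ :=
  if r < p.1 i then virtualValue f (p.1 i) * p.2 i else 0

lemma virtualWeight_of_le {i : Fin n} (hi : p.1 i ≤ r) : virtualWeight f r p i = 0 :=
  if_neg hi.not_gt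

lemma virtualWeight_of_lt {i : Fin n} (hi : r < p.1 i) :
    virtualWeight f r p i = virtualValue f (p.1 i) * p.2 i :=
  if_pos hi

lemma Outcome.IsSNE.sum_virtualValue_eq {y : ℝ → ℝ → ℝ} {o : Outcome n} (ho : o.IsSNE y s p)
    (hy : HasReservePrice y r) (hS : Antitone (slotEffect s)) (hw : ∀ i, 0 < p.2 i)
    (hne : ∀ i, p.1 i ≠ r) (f : ℝ → ℝ) :
    ∑ i, virtualValue f (p.1 i) * p.2 i * o.alloc y s p.2 i =
      ∑ i, virtualWeight f r p i * slotEffect s (o.rank i) := by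
  refine Finset.sum_congr rfl fun i _ => ?_
  rcases (hne i).lt_or_gt with hi | hi
  · rw [ho.alloc_eq_zero hy hS hw hi, virtualWeight_of_le hi.le, mul_zero, zero_mul]
  · rw [ho.alloc_eq_slotEffect hy hS hw hi, virtualWeight_of_lt hi]

variable {o₁ o₂ : Outcome n}

/-- The two rankings disagree about a pair only in favour of the less relevant one under the
proposed ranking, and that is where a higher net value means a higher virtual value. -/
lemma virtualWeight_le_of_disagree (hf : IsRegularDensity f) (hS : Antitone (slotEffect s))
    (hr_pos : 0 < r)
    (hr : MonotoneOn (fun t => virtualValue f t / (t - r)) (Set.Ioi r ∩ valueRange f))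
    (hw : ∀ i, 0 < p.2 i) (hne : ∀ i, p.1 i ≠ r) (hF : ∀ i, valueCDF f (p.1 i) < 1)
    (h₁ : o₁.IsSNE (proposedRanking r) s p) (h₂ : o₂.IsSNE (standardRanking r) s p) {i j : Fin n}
    (hij₁ : slotEffect s (o₁.rank j) < slotEffect s (o₁.rank i))
    (hij₂ : slotEffect s (o₂.rank i) < slotEffect s (o₂.rank j)) :
    virtualWeight f r p j ≤ virtualWeight f r p i := by
  have hnet : netValue r p j ≤ netValue r p i := (h₁.isEnvyFree hS hw).le_of_slot_lt hij₁
  rcases (hne j).lt_or_gt with hj | hj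
  · have hi : p.1 i ≤ r := by
      by_contra! hi
      exact hj.not_ge
        (h₂.le_of_slotEffect_lt (hasReservePrice_standardRanking hr_pos.le) hS hw hij₂ hi)
    rw [virtualWeight_of_le hj.le, virtualWeight_of_le hi]
  have hi : r < p.1 i :=
    (netValue_pos_iff hw).mp (((netValue_pos_iff hw).mpr hj).trans_le hnet)
  rw [netValue_of_lt hi, netValue_of_lt hj] at hnet
  have hwij : p.2 i ≤ p.2 j := by
    by_contra! hlt
    have hstd := h₂.standard_order hr_pos.le hS hw hij₂ hj hi hlt.le
    linarith [mul_lt_mul_of_pos_left hlt hr_pos]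
  rw [virtualWeight_of_lt hi, virtualWeight_of_lt hj]
  exact hf.virtualValue_mul_le_mul hr ⟨hj, hr_pos.trans hj, hF j⟩ ⟨hi, hr_pos.trans hi, hF i⟩
    (hw i) hwij hnet

lemma sum_virtualValue_le (hf : IsRegularDensity f) (hS : Antitone (slotEffect s))
    (hr_pos : 0 < r)
    (hr : MonotoneOn (fun t => virtualValue f t / (t - r)) (Set.Ioi r ∩ valueRange f))
    (hw : ∀ i, 0 < p.2 i) (hne : ∀ i, p.1 i ≠ r) (hF : ∀ i, valueCDF f (p.1 i) < 1)
    (h₁ : o₁.IsSNE (proposedRanking r) s p) (h₂ : o₂.IsSNE (standardRanking r) s p) :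
    ∑ i, virtualValue f (p.1 i) * p.2 i * o₂.alloc (standardRanking r) s p.2 i ≤
      ∑ i, virtualValue f (p.1 i) * p.2 i * o₁.alloc (proposedRanking r) s p.2 i := by
  rw [h₁.sum_virtualValue_eq (hasReservePrice_proposedRanking r) hS hw hne,
    h₂.sum_virtualValue_eq (hasReservePrice_standardRanking hr_pos.le) hS hw hne]
  exact sum_mul_rank_le hS fun _ _ => virtualWeight_le_of_disagree hf hS hr_pos hr hw hne hF h₁ h₂

/-- Types for which the two rankings put different advertisers first: only `i` and `j` have values
above the reserve price, and subtracting it puts `i` before the more relevant `j`. -/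
structure IsReversal (r : ℝ) (i j : Fin n) (p : Types n) : Prop where
  lt_left : r < p.1 i
  lt_right : r < p.1 j
  lt_of_ne : ∀ l, l ≠ i → l ≠ j → p.1 l < r
  relevance_lt : p.2 i < p.2 j
  value_lt : p.1 i * p.2 i < p.1 j * p.2 j
  netValue_lt : (p.1 j - r) * p.2 j < (p.1 i - r) * p.2 i

namespace IsReversal

variable {i j : Fin n}

lemma rank_proposedRanking (hp : IsReversal r i j p) (hS : Antitone (slotEffect s))
    (h01 : slotEffect s 1 < slotEffect s 0) (hw : ∀ i, 0 < p.2 i)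
    (h₁ : o₁.IsSNE (proposedRanking r) s p) : (o₁.rank i : ℕ) = 0 := by
  refine rank_eq_zero hS h01 fun l => ?_
  by_contra! hlt
  have hnet : netValue r p i ≤ netValue r p l := (h₁.isEnvyFree hS hw).le_of_slot_lt hlt
  have hl : r < p.1 l :=
    (netValue_pos_iff hw).mp (((netValue_pos_iff hw).mpr hp.lt_left).trans_le hnet)
  have hli : l ≠ i := fun h => hlt.ne' (by rw [h])
  obtain rfl : l = j := by
    by_contra hlj
    exact hl.not_gt (hp.lt_of_ne l hli hlj)
  rw [netValue_of_lt hp.lt_left, netValue_of_lt hl] at hnet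
  exact hnet.not_gt hp.netValue_lt

lemma rank_standardRanking (hp : IsReversal r i j p) (hr : 0 ≤ r) (hS : Antitone (slotEffect s))
    (h01 : slotEffect s 1 < slotEffect s 0) (hw : ∀ i, 0 < p.2 i)
    (h₂ : o₂.IsSNE (standardRanking r) s p) : (o₂.rank j : ℕ) = 0 := by
  refine rank_eq_zero hS h01 fun l => ?_
  by_contra! hlt
  have hl : r ≤ p.1 l :=
    h₂.le_of_slotEffect_lt (hasReservePrice_standardRanking hr) hS hw hlt hp.lt_right
  have hlj : l ≠ j := fun h => hlt.ne' (by rw [h])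
  obtain rfl : l = i := by
    by_contra hli
    exact hl.not_gt (hp.lt_of_ne l hli hlj)
  exact hp.value_lt.not_ge
    (h₂.standard_order hr hS hw hlt hp.lt_left hp.lt_right hp.relevance_lt.le)

end IsReversal

lemma sum_virtualValue_lt (hf : IsRegularDensity f) (hS : Antitone (slotEffect s))
    (h01 : slotEffect s 1 < slotEffect s 0) (hr_pos : 0 < r)
    (hr : MonotoneOn (fun t => virtualValue f t / (t - r)) (Set.Ioi r ∩ valueRange f))
    (hw : ∀ i, 0 < p.2 i) (hne : ∀ i, p.1 i ≠ r) (hF : ∀ i, valueCDF f (p.1 i) < 1)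
    (h₁ : o₁.IsSNE (proposedRanking r) s p) (h₂ : o₂.IsSNE (standardRanking r) s p)
    {i j : Fin n} (hp : IsReversal r i j p) :
    ∑ i, virtualValue f (p.1 i) * p.2 i * o₂.alloc (standardRanking r) s p.2 i <
      ∑ i, virtualValue f (p.1 i) * p.2 i * o₁.alloc (proposedRanking r) s p.2 i := by
  rw [h₁.sum_virtualValue_eq (hasReservePrice_proposedRanking r) hS hw hne,
    h₂.sum_virtualValue_eq (hasReservePrice_standardRanking hr_pos.le) hS hw hne]
  refine sum_mul_rank_lt hS
    (fun _ _ => virtualWeight_le_of_disagree hf hS hr_pos hr hw hne hF h₁ h₂) h01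
    (hp.rank_proposedRanking hS h01 hw h₁) (hp.rank_standardRanking hr_pos.le hS h01 hw h₂) ?_
  rw [virtualWeight_of_lt hp.lt_left, virtualWeight_of_lt hp.lt_right]
  exact hf.virtualValue_mul_lt_mul hr ⟨hp.lt_right, hr_pos.trans hp.lt_right, hF j⟩
    ⟨hp.lt_left, hr_pos.trans hp.lt_left, hF i⟩ (hw i) hp.relevance_lt.le hp.netValue_lt

end Pointwise

/-! ### Reversals have positive probability -/

section Reversal

variable {n : ℕ} {f : ℝ → ℝ} {r : ℝ}

lemma exists_reversal_intervals {u v w : ℝ} (hr : 0 < r) (hru : r < u) (hw : 0 < w)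
    (hwv : w < v) :
    ∃ a b c, r < a ∧ a < b ∧ b ≤ u ∧ r < c ∧ c ≤ u ∧ b * w ≤ r * v ∧
      (c - r) * v ≤ (a - r) * w := by
  have hv : 0 < v := hw.trans hwv
  have hr_lt : r < r * v / w := (lt_div_iff₀ hw).mpr (mul_lt_mul_of_pos_left hwv hr)
  obtain ⟨a, hra, hab⟩ := exists_between (lt_min hru hr_lt)
  have har : 0 < a - r := sub_pos.mpr hra
  have hle : (a - r) * w / v ≤ a - r :=
    (div_le_iff₀ hv).mpr (mul_le_mul_of_nonneg_left hwv.le har.le)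
  refine ⟨a, min u (r * v / w), r + (a - r) * w / v, hra, hab, min_le_left _ _,
    lt_add_of_pos_right r (by positivity), ?_, (le_div_iff₀ hw).mp (min_le_right _ _), ?_⟩
  · linarith [min_le_left u (r * v / w)]
  · rw [add_sub_cancel_left, div_mul_cancel₀ _ hv.ne']

lemma isReversal_of_mem_Ioo {i j : Fin n} {p : Types n} {a b c : ℝ} (hw : ∀ i, 0 < p.2 i)
    (hij : p.2 i < p.2 j) (ha : r < a) (hb : b * p.2 i ≤ r * p.2 j)
    (hc : (c - r) * p.2 j ≤ (a - r) * p.2 i) (hi : p.1 i ∈ Set.Ioo a b)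
    (hj : p.1 j ∈ Set.Ioo r c) (hl : ∀ l, l ≠ i → l ≠ j → p.1 l < r) : IsReversal r i j p where
  lt_left := ha.trans hi.1
  lt_right := hj.1
  lt_of_ne := hl
  relevance_lt := hij
  value_lt := calc
    p.1 i * p.2 i < b * p.2 i := mul_lt_mul_of_pos_right hi.2 (hw i)
    _ ≤ r * p.2 j := hb
    _ < p.1 j * p.2 j := mul_lt_mul_of_pos_right hj.1 (hw j)
  netValue_lt := calc
    (p.1 j - r) * p.2 j < (c - r) * p.2 j :=
      mul_lt_mul_of_pos_right (sub_lt_sub_right hj.2 r) (hw j)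
    _ ≤ (a - r) * p.2 i := hc
    _ < (p.1 i - r) * p.2 i := mul_lt_mul_of_pos_right (sub_lt_sub_right hi.1 r) (hw i)

lemma measure_isReversal_ne_zero (hf : IsRegularDensity f) (hr : r ∈ valueRange f) {w : Fin n → ℝ}
    (hw : ∀ i, 0 < w i) {i j : Fin n} (hij : w i < w j) :
    Measure.pi (fun _ : Fin n => valueLaw f) {θ | IsReversal r i j (θ, w)} ≠ 0 := by
  have := hf.isProbabilityMeasure
  have hji : j ≠ i := fun h => hij.ne' (by rw [h])
  obtain ⟨u, ⟨-, hu⟩, hru⟩ : (valueRange f ∩ Set.Ioi r).Nonempty :=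
    Filter.nonempty_of_mem (Filter.inter_mem
      (mem_nhdsWithin_of_mem_nhds ((isOpen_valueRange f).mem_nhds hr)) self_mem_nhdsWithin)
  obtain ⟨a, b, c, hra, hab, hbu, hrc, hcu, hb, hc⟩ :=
    exists_reversal_intervals hr.1 hru (hw i) hij
  set box : Fin n → Set ℝ := fun l =>
    if l = i then Set.Ioo a b else if l = j then Set.Ioo r c else Set.Ioo 0 r
  have hbox : Set.univ.pi box ⊆ {θ | IsReversal r i j (θ, w)} := by
    intro θ hθ
    have hθ (l) : θ l ∈ box l := hθ l (Set.mem_univ l)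
    refine isReversal_of_mem_Ioo hw hij hra hb hc (by simpa [box] using hθ i)
      (by simpa [box, hji] using hθ j) fun l hli hlj => ?_
    have hl : θ l ∈ Set.Ioo 0 r := by simpa [box, hli, hlj] using hθ l
    exact hl.2
  have hpos : Measure.pi (fun _ : Fin n => valueLaw f) (Set.univ.pi box) ≠ 0 := by
    rw [Measure.pi_pi, Finset.prod_ne_zero_iff]
    intro l _
    have hcdf {t : ℝ} (ht : t ≤ u) : valueCDF f t < 1 := (valueCDF_mono f ht).trans_lt hu
    dsimp only [box]
    split_ifs
    · exact (hf.valueLaw_Ioo_pos (hr.1.trans hra).le hab (hcdf hbu)).ne'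
    · exact (hf.valueLaw_Ioo_pos hr.1.le hrc (hcdf hcu)).ne'
    · exact (hf.valueLaw_Ioo_pos le_rfl hr.1 hr.2).ne'
  exact fun h => hpos (measure_mono_null hbox h)

lemma not_ae_not_isReversal (hf : IsRegularDensity f) (hr : r ∈ valueRange f)
    {ν : Measure (Fin n → ℝ)} [SFinite ν] (hw : ∀ᵐ w ∂ν, ∀ i, 0 < w i)
    (hw_ne : ¬ ∀ᵐ w ∂ν, ∀ i j, w i = w j) :
    ¬ ∀ᵐ p ∂typeLaw f ν, ∀ i j, ¬ IsReversal r i j p := by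
  have := hf.isProbabilityMeasure
  refine fun h => hw_ne ?_
  have hswap : ∀ᵐ w ∂ν, ∀ᵐ θ ∂Measure.pi fun _ : Fin n => valueLaw f,
      ∀ i j, ¬ IsReversal r i j (θ, w) :=
    Measure.ae_ae_of_ae_prod (Measure.measurePreserving_swap.quasiMeasurePreserving.ae h)
  filter_upwards [hswap, hw] with w hrev hw i j
  have hle (i j : Fin n) : w i ≤ w j := by
    by_contra! hlt
    exact measure_isReversal_ne_zero hf hr hw hlt
      (measure_eq_zero_iff_ae_notMem.mpr (hrev.mono fun θ hθ => hθ j i))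
  exact (hle i j).antisymm (hle j i)

end Reversal

/-! ### Measurability and integrability -/

section Integrability

variable {n m : ℕ} {s : Fin m → ℝ} {f : ℝ → ℝ} {r : ℝ} {y : ℝ → ℝ → ℝ} {o : Types n → Outcome n}

lemma measurable_standardRanking (r : ℝ) : Measurable (Function.uncurry (standardRanking r)) :=
  Measurable.ite (measurableSet_le measurable_const measurable_fst)
    (measurable_fst.mul measurable_snd) measurable_const

lemma Outcome.nextScore_rank_eq (y : ℝ → ℝ → ℝ) (w : Fin n → ℝ) (o : Outcome n) (i : Fin n) :
    o.nextScore y w (o.rank i) =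
      ∑ j, if (o.rank j : ℕ) = o.rank i + 1 then y (o.bid j) (w j) else 0 := by
  unfold nextScore
  split_ifs with h
  · rw [Finset.sum_eq_single (o.rank.symm ⟨o.rank i + 1, h⟩)]
    · simp
    · intro j _ hj
      exact if_neg fun e => hj (o.rank.eq_symm_apply.mpr (Fin.ext e))
    · simp
  · exact (Finset.sum_eq_zero fun j _ => if_neg fun e => h (e.symm.trans_lt (o.rank j).is_lt)).symm

namespace IsMeasurableRule

variable {P : Measure (Types n)}

lemma aemeasurable_score (ho : IsMeasurableRule P o) (hy : Measurable (Function.uncurry y))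
    (i : Fin n) : AEMeasurable (fun p => y ((o p).bid i) (p.2 i)) P :=
  hy.comp_aemeasurable ((ho i).1.prodMk (measurable_relevance i).aemeasurable)

lemma aemeasurable_alloc (ho : IsMeasurableRule P o) (hy : Measurable (Function.uncurry y))
    (s : Fin m → ℝ) (i : Fin n) : AEMeasurable (fun p => (o p).alloc y s p.2 i) P := by
  have halloc : Measurable fun x : ℝ × Fin n => if 0 < x.1 then slotEffect s x.2 else 0 :=
    Measurable.ite (measurableSet_lt measurable_const measurable_fst)
      ((Measurable.of_discrete (f := fun k : Fin n => slotEffect s k)).comp measurable_snd)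
      measurable_const
  exact halloc.comp_aemeasurable ((ho.aemeasurable_score hy i).prodMk (ho i).2)

lemma aemeasurable_nextScore (ho : IsMeasurableRule P o) (hy : Measurable (Function.uncurry y))
    (i : Fin n) : AEMeasurable (fun p => (o p).nextScore y p.2 ((o p).rank i)) P := by
  simp only [Outcome.nextScore_rank_eq]
  refine Finset.aemeasurable_fun_sum _ fun j _ => ?_
  have hterm : Measurable fun x : (Fin n × Fin n) × ℝ =>
      if (x.1.1 : ℕ) = x.1.2 + 1 then x.2 else 0 :=
    Measurable.ite
      (measurable_fst (MeasurableSet.of_discrete (s := {x : Fin n × Fin n | (x.1 : ℕ) = x.2 + 1})))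
      measurable_snd measurable_const
  exact hterm.comp_aemeasurable (((ho j).2.prodMk (ho i).2).prodMk (ho.aemeasurable_score hy j))

end IsMeasurableRule

variable {ν : Measure (Fin n → ℝ)} [IsProbabilityMeasure ν]

namespace SelectsSNE

lemma integrable_surplus (ho : SelectsSNE y s (typeLaw f ν) o) (hf : IsRegularDensity f)
    (hS : Antitone (slotEffect s)) (hw_pos : ∀ᵐ w ∂ν, ∀ i, 0 < w i)
    (hw_int : ∀ i, Integrable (fun w : Fin n → ℝ => w i) ν)
    (hy : Measurable (Function.uncurry y)) (i : Fin n) :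
    Integrable (fun p => p.1 i * p.2 i * (o p).alloc y s p.2 i) (typeLaw f ν) := by
  have := hf.isProbabilityMeasure
  have hvalue : Integrable (fun θ : Fin n → ℝ => θ i) (Measure.pi fun _ => valueLaw f) :=
    (measurePreserving_eval (fun _ => valueLaw f) i).integrable_comp_of_integrable hf.integrable_id
  have hdom : Integrable (fun p : Types n => p.1 i * p.2 i * slotEffect s 0) (typeLaw f ν) :=
    (hvalue.mul_prod (hw_int i)).mul_const _
  refine hdom.mono' (((measurable_value i).mul (measurable_relevance i)).aemeasurable.mul
    (ho.1.aemeasurable_alloc hy s i)).aestronglyMeasurable ?_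
  filter_upwards [ae_value hf.ae_pos, ae_relevance hw_pos] with p hθ hw
  have hclick : 0 ≤ p.1 i * p.2 i := mul_nonneg (hθ i).le (hw i).le
  rw [Real.norm_of_nonneg (mul_nonneg hclick (Outcome.alloc_nonneg hS i))]
  exact mul_le_mul_of_nonneg_left (Outcome.alloc_le hS i) hclick

lemma integrable_inverseHazard (ho : SelectsSNE y s (typeLaw f ν) o) (hf : IsRegularDensity f)
    (hS : Antitone (slotEffect s)) (hr : 0 < r) (hw_pos : ∀ᵐ w ∂ν, ∀ i, 0 < w i)
    (hw_int : ∀ i, Integrable (fun w : Fin n → ℝ => w i) ν)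
    (hyr : HasReservePrice y r) (hy : Measurable (Function.uncurry y)) (i : Fin n) :
    Integrable (fun p => p.2 i * (o p).alloc y s p.2 i * inverseHazard f (p.1 i))
      (typeLaw f ν) := by
  have := hf.isProbabilityMeasure
  have hdom : Integrable (fun p : Types n => p.2 i * slotEffect s 0 * inverseHazard f r)
      (typeLaw f ν) := (((hw_int i).comp_snd _).mul_const _).mul_const _
  refine hdom.mono' (((measurable_relevance i).aemeasurable.mul
    (ho.1.aemeasurable_alloc hy s i)).mul
      (hf.measurable_inverseHazard.comp (measurable_value i)).aemeasurable).aestronglyMeasurable ?_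
  filter_upwards [ho.2, ae_relevance hw_pos] with p hop hw
  have hnonneg : 0 ≤ p.2 i * (o p).alloc y s p.2 i :=
    mul_nonneg (hw i).le (Outcome.alloc_nonneg hS i)
  have hbound : p.2 i * (o p).alloc y s p.2 i ≤ p.2 i * slotEffect s 0 :=
    mul_le_mul_of_nonneg_left (Outcome.alloc_le hS i) (hw i).le
  rw [Real.norm_of_nonneg (mul_nonneg hnonneg (hf.inverseHazard_nonneg _))]
  rcases lt_or_ge (p.1 i) r with hi | hi
  · rw [hop.alloc_eq_zero hyr hS hw hi, mul_zero, zero_mul]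
    exact mul_nonneg (hnonneg.trans hbound) (hf.inverseHazard_nonneg r)
  · exact mul_le_mul hbound (hf.inverseHazard_antitoneOn hr (hr.trans_le hi) hi)
      (hf.inverseHazard_nonneg _) (hnonneg.trans hbound)

lemma integrable_utility (ho : SelectsSNE (proposedRanking r) s (typeLaw f ν) o)
    (hf : IsRegularDensity f) (hS : Antitone (slotEffect s)) (hr : 0 ≤ r)
    (hw_pos : ∀ᵐ w ∂ν, ∀ i, 0 < w i)
    (hw_int : ∀ i, Integrable (fun w : Fin n → ℝ => w i) ν) (i : Fin n) :
    Integrable (fun p => (o p).utility (proposedRanking r) s p i) (typeLaw f ν) := by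
  have := hf.isProbabilityMeasure
  have hy := measurable_proposedRanking r
  refine (ho.integrable_surplus hf hS hw_pos hw_int hy i).mono'
    (AEMeasurable.aestronglyMeasurable ?_) ?_
  · have hmeas : AEMeasurable (fun p => ((p.1 i - r) * p.2 i -
        (o p).nextScore (proposedRanking r) p.2 ((o p).rank i)) *
          (o p).alloc (proposedRanking r) s p.2 i) (typeLaw f ν) :=
      ((((measurable_value i).sub_const r).mul (measurable_relevance i)).aemeasurable.sub
        (ho.1.aemeasurable_nextScore hy i)).mul (ho.1.aemeasurable_alloc hy s i)
    refine hmeas.congr ?_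
    filter_upwards [ae_relevance hw_pos] with p hw
    rw [Outcome.utility]
    linear_combination (o p).alloc (proposedRanking r) s p.2 i *
      Outcome.priceAt_proposedRanking_mul (r := r) (o := o p) hw ((o p).rank i) i
  · filter_upwards [ho.2, ae_relevance hw_pos] with p hop hw
    rw [Real.norm_of_nonneg (hop.utility_nonneg hw i), Outcome.utility, sub_mul, sub_mul]
    exact sub_le_self _
      (Outcome.payment_nonneg (hasReservePrice_proposedRanking r) hr hS hw i)

end SelectsSNE

end Integrability

/-! ### Expected revenue and virtual surplus -/

section Revenue

lemma integral_sum_sub {α ι : Type*} [MeasurableSpace α] {μ : Measure α} [Fintype ι]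
    {g h : ι → α → ℝ} (hg : ∀ i, Integrable (g i) μ) (hh : ∀ i, Integrable (h i) μ) :
    ∫ a, ∑ i, (g i a - h i a) ∂μ = ∑ i, ((∫ a, g i a ∂μ) - ∫ a, h i a ∂μ) :=
  (integral_finsetSum _ fun i _ => (hg i).sub (hh i)).trans
    (Finset.sum_congr rfl fun i _ => integral_sub (hg i) (hh i))

variable {n m : ℕ} {s : Fin m → ℝ} {f : ℝ → ℝ} {r : ℝ} {y : ℝ → ℝ → ℝ} {o : Types n → Outcome n}

section Rule

variable {P : Measure (Types n)}

lemma expectedRevenue_eq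
    (hsurplus : ∀ i, Integrable (fun p => p.1 i * p.2 i * (o p).alloc y s p.2 i) P)
    (hutility : ∀ i, Integrable (fun p => (o p).utility y s p i) P) :
    expectedRevenue y s P o = ∑ i, ((∫ p, p.1 i * p.2 i * (o p).alloc y s p.2 i ∂P) -
      ∫ p, (o p).utility y s p i ∂P) := by
  rw [← integral_sum_sub hsurplus hutility, expectedRevenue]
  refine integral_congr_ae (ae_of_all _ fun p => Finset.sum_congr rfl fun i _ => ?_)
  rw [Outcome.utility]
  ring

lemma virtualSurplus_integrand_eq (f : ℝ → ℝ) (y : ℝ → ℝ → ℝ) (s : Fin m → ℝ)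
    (o : Types n → Outcome n) (p : Types n) :
    ∑ i, virtualValue f (p.1 i) * p.2 i * (o p).alloc y s p.2 i =
      ∑ i, (p.1 i * p.2 i * (o p).alloc y s p.2 i -
        p.2 i * (o p).alloc y s p.2 i * inverseHazard f (p.1 i)) := by
  refine Finset.sum_congr rfl fun i _ => ?_
  rw [virtualValue_eq]
  ring

lemma virtualSurplus_eq
    (hsurplus : ∀ i, Integrable (fun p => p.1 i * p.2 i * (o p).alloc y s p.2 i) P)
    (hhazard : ∀ i,
      Integrable (fun p => p.2 i * (o p).alloc y s p.2 i * inverseHazard f (p.1 i)) P) :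
    virtualSurplus f y s P o = ∑ i, ((∫ p, p.1 i * p.2 i * (o p).alloc y s p.2 i ∂P) -
      ∫ p, p.2 i * (o p).alloc y s p.2 i * inverseHazard f (p.1 i) ∂P) := by
  rw [← integral_sum_sub hsurplus hhazard, virtualSurplus]
  simp_rw [virtualSurplus_integrand_eq]

end Rule

variable {ν : Measure (Fin n → ℝ)} [IsProbabilityMeasure ν]

lemma SelectsSNE.integral_utility_le (ho : SelectsSNE (proposedRanking r) s (typeLaw f ν) o)
    (hf : IsRegularDensity f) (hS : Antitone (slotEffect s)) (hr : 0 < r)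
    (hw_pos : ∀ᵐ w ∂ν, ∀ i, 0 < w i)
    (hw_int : ∀ i, Integrable (fun w : Fin n → ℝ => w i) ν) (i : Fin n) :
    ∫ p, (o p).utility (proposedRanking r) s p i ∂typeLaw f ν ≤
      ∫ p, p.2 i * (o p).alloc (proposedRanking r) s p.2 i * inverseHazard f (p.1 i)
        ∂typeLaw f ν := by
  have := hf.isProbabilityMeasure
  have hutility_nonneg : 0 ≤ᵐ[typeLaw f ν] fun p => (o p).utility (proposedRanking r) s p i := by
    filter_upwards [ho.2, ae_relevance hw_pos] with p hop hw
    exact hop.utility_nonneg hw i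
  have hhazard_nonneg : 0 ≤ᵐ[typeLaw f ν] fun p =>
      p.2 i * (o p).alloc (proposedRanking r) s p.2 i * inverseHazard f (p.1 i) := by
    filter_upwards [ae_relevance hw_pos] with p hw
    exact mul_nonneg (mul_nonneg (hw i).le (Outcome.alloc_nonneg hS i)) (hf.inverseHazard_nonneg _)
  rw [← ENNReal.ofReal_le_ofReal_iff (integral_nonneg_of_ae hhazard_nonneg),
    ofReal_integral_eq_lintegral_ofReal (ho.integrable_utility hf hS hr.le hw_pos hw_int i)
      hutility_nonneg,
    ofReal_integral_eq_lintegral_ofReal (ho.integrable_inverseHazard hf hS hr hw_pos hw_int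
      (hasReservePrice_proposedRanking r) (measurable_proposedRanking r) i) hhazard_nonneg]
  exact lintegral_utility_le hf hS hr.le hw_pos ho.2 i

theorem SelectsSNE.virtualSurplus_le_expectedRevenue
    (ho : SelectsSNE (proposedRanking r) s (typeLaw f ν) o) (hf : IsRegularDensity f)
    (hS : Antitone (slotEffect s)) (hr : 0 < r) (hw_pos : ∀ᵐ w ∂ν, ∀ i, 0 < w i)
    (hw_int : ∀ i, Integrable (fun w : Fin n → ℝ => w i) ν) :
    virtualSurplus f (proposedRanking r) s (typeLaw f ν) o ≤
      expectedRevenue (proposedRanking r) s (typeLaw f ν) o := by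
  have hy := measurable_proposedRanking r
  have hsurplus := ho.integrable_surplus hf hS hw_pos hw_int hy
  rw [expectedRevenue_eq hsurplus (ho.integrable_utility hf hS hr.le hw_pos hw_int),
    virtualSurplus_eq hsurplus (ho.integrable_inverseHazard hf hS hr hw_pos hw_int
      (hasReservePrice_proposedRanking r) hy)]
  exact Finset.sum_le_sum fun i _ =>
    sub_le_sub_left (ho.integral_utility_le hf hS hr hw_pos hw_int i) _

lemma SelectsSNE.integrable_virtualSurplus (ho : SelectsSNE y s (typeLaw f ν) o)
    (hf : IsRegularDensity f) (hS : Antitone (slotEffect s)) (hr : 0 < r)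
    (hw_pos : ∀ᵐ w ∂ν, ∀ i, 0 < w i) (hw_int : ∀ i, Integrable (fun w : Fin n → ℝ => w i) ν)
    (hyr : HasReservePrice y r) (hy : Measurable (Function.uncurry y)) :
    Integrable (fun p => ∑ i, virtualValue f (p.1 i) * p.2 i * (o p).alloc y s p.2 i)
      (typeLaw f ν) := by
  simp_rw [virtualSurplus_integrand_eq]
  exact integrable_finsetSum _ fun i _ => (ho.integrable_surplus hf hS hw_pos hw_int hy i).sub
    (ho.integrable_inverseHazard hf hS hr hw_pos hw_int hyr hy i)

theorem virtualSurplus_standardRanking_lt {o₁ o₂ : Types n → Outcome n} (hf : IsRegularDensity f)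
    (hS : Antitone (slotEffect s)) (h01 : slotEffect s 1 < slotEffect s 0)
    (hr_mem : r ∈ valueRange f)
    (hr : MonotoneOn (fun t => virtualValue f t / (t - r)) (Set.Ioi r ∩ valueRange f))
    (hw_pos : ∀ᵐ w ∂ν, ∀ i, 0 < w i)
    (hw_int : ∀ i, Integrable (fun w : Fin n → ℝ => w i) ν)
    (hw_ne : ¬ ∀ᵐ w ∂ν, ∀ i j, w i = w j)
    (h₁ : SelectsSNE (proposedRanking r) s (typeLaw f ν) o₁)
    (h₂ : SelectsSNE (standardRanking r) s (typeLaw f ν) o₂) :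
    virtualSurplus f (standardRanking r) s (typeLaw f ν) o₂ <
      virtualSurplus f (proposedRanking r) s (typeLaw f ν) o₁ := by
  have := hf.isProbabilityMeasure
  have hint₁ := h₁.integrable_virtualSurplus hf hS hr_mem.1 hw_pos hw_int
    (hasReservePrice_proposedRanking r) (measurable_proposedRanking r)
  have hint₂ := h₂.integrable_virtualSurplus hf hS hr_mem.1 hw_pos hw_int
    (hasReservePrice_standardRanking hr_mem.1.le) (measurable_standardRanking r)
  have htypes : ∀ᵐ p ∂typeLaw f ν,
      (∀ i, 0 < p.2 i) ∧ (∀ i, p.1 i ≠ r) ∧ ∀ i, valueCDF f (p.1 i) < 1 :=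
    (ae_relevance hw_pos).and ((ae_value
      (measure_eq_zero_iff_ae_notMem.mp (valueLaw_singleton f r))).and
        (ae_value hf.ae_valueCDF_lt_one))
  have hle : ∀ᵐ p ∂typeLaw f ν,
      ∑ i, virtualValue f (p.1 i) * p.2 i * (o₂ p).alloc (standardRanking r) s p.2 i ≤
        ∑ i, virtualValue f (p.1 i) * p.2 i * (o₁ p).alloc (proposedRanking r) s p.2 i := by
    filter_upwards [h₁.2, h₂.2, htypes] with p hp₁ hp₂ ⟨hw, hne, hF⟩
    exact sum_virtualValue_le hf hS hr_mem.1 hr hw hne hF hp₁ hp₂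
  refine (integral_mono_ae hint₂ hint₁ hle).lt_of_ne fun heq => ?_
  refine not_ae_not_isReversal hf hr_mem hw_pos hw_ne ?_
  filter_upwards [(integral_eq_iff_of_ae_le hint₂ hint₁ hle).mp heq, h₁.2, h₂.2, htypes] with
    p hp hp₁ hp₂ ⟨hw, hne, hF⟩ i j hrev
  exact (sum_virtualValue_lt hf hS h01 hr_mem.1 hr hw hne hF hp₁ hp₂ hrev).ne hp

lemma SelectsLowestSNE.selectsSNE {P : Measure (Types n)} (ho : SelectsLowestSNE y s P o) :
    SelectsSNE y s P o :=
  ⟨ho.1, ho.2.mono fun _ hp => hp.1⟩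

lemma valueCDF_lt_one_of_virtualValue_eq_zero {t : ℝ} (ht : t ≠ 0) (h : virtualValue f t = 0) :
    valueCDF f t < 1 := by
  refine (valueCDF_le_one f t).lt_of_ne fun h1 => ht ?_
  rwa [virtualValue, h1, sub_self, zero_div, sub_zero] at h

end Revenue

end GSP

end

theorem theorem2_general {n m : ℕ} (s : Fin m → ℝ) (hs : Antitone (GSP.slotEffect s))
    (hs_lt : GSP.slotEffect s 1 < GSP.slotEffect s 0)
    (f : ℝ → ℝ) (hf : GSP.IsRegularDensity f)
    (ν : MeasureTheory.Measure (Fin n → ℝ)) [MeasureTheory.IsProbabilityMeasure ν]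
    (hw_pos : ∀ᵐ w ∂ν, ∀ i, 0 < w i)
    (hw_int : ∀ i, MeasureTheory.Integrable (fun w : Fin n → ℝ => w i) ν)
    (hw_ne : ¬ ∀ᵐ w ∂ν, ∀ i j, w i = w j)
    (r : ℝ) (hr_pos : 0 < r) (hr_cdf : GSP.valueCDF f r < 1)
    (hr : ∀ t, r < t → GSP.valueCDF f t < 1 →
      r ≤ t - GSP.virtualValue f t / deriv (GSP.virtualValue f) t)
    (o₁ o₂ : GSP.Types n → GSP.Outcome n)
    (h₁ : GSP.SelectsSNE (GSP.proposedRanking r) s (GSP.typeLaw f ν) o₁)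
    (h₂ : GSP.SelectsSNE (GSP.standardRanking r) s (GSP.typeLaw f ν) o₂)
    (h₂_bound : GSP.RespectsBound f (GSP.standardRanking r) s (GSP.typeLaw f ν) o₂) :
    GSP.expectedRevenue (GSP.standardRanking r) s (GSP.typeLaw f ν) o₂ <
      GSP.expectedRevenue (GSP.proposedRanking r) s (GSP.typeLaw f ν) o₁ :=
  calc GSP.expectedRevenue (GSP.standardRanking r) s (GSP.typeLaw f ν) o₂
      ≤ GSP.virtualSurplus f (GSP.standardRanking r) s (GSP.typeLaw f ν) o₂ := h₂_bound
    _ < GSP.virtualSurplus f (GSP.proposedRanking r) s (GSP.typeLaw f ν) o₁ :=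
      GSP.virtualSurplus_standardRanking_lt hf hs hs_lt ⟨hr_pos, hr_cdf⟩
        (hf.monotoneOn_virtualValue_div fun t ht => hr t ht.1 ht.2.2) hw_pos hw_int hw_ne h₁ h₂
    _ ≤ GSP.expectedRevenue (GSP.proposedRanking r) s (GSP.typeLaw f ν) o₁ :=
      h₁.virtualSurplus_le_expectedRevenue hf hs hr_pos hw_pos hw_int

theorem theorem2 {n m : ℕ} (hm : 0 < m)
    (s : Fin m → ℝ) (hs : StrictAnti s) (hs_pos : ∀ k, 0 < s k)
    (f : ℝ → ℝ) (hf : GSP.IsRegularDensity f)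
    (ν : MeasureTheory.Measure (Fin n → ℝ)) [MeasureTheory.IsProbabilityMeasure ν]
    (hw_pos : ∀ᵐ w ∂ν, ∀ i, 0 < w i)
    (hw_int : ∀ i, MeasureTheory.Integrable (fun w : Fin n → ℝ => w i) ν)
    (hw_ne : ¬ ∀ᵐ w ∂ν, ∀ i j, w i = w j)
    (θbar : ℝ) (hθbar : GSP.virtualValue f θbar = 0)
    (r : ℝ) (hr_pos : 0 < r) (hr_le : r ≤ θbar)
    (hr : ∀ t, r ≤ t → GSP.valueCDF f t < 1 →
      r ≤ t - GSP.virtualValue f t / deriv (GSP.virtualValue f) t)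
    (o₂ : GSP.Types n → GSP.Outcome n)
    (h₂ : GSP.SelectsSNE (GSP.standardRanking r) s (GSP.typeLaw f ν) o₂)
    (h₂_bound : GSP.RespectsBound f (GSP.standardRanking r) s (GSP.typeLaw f ν) o₂) :
    (∀ o₁ : GSP.Types n → GSP.Outcome n,
      GSP.SelectsSNE (GSP.proposedRanking r) s (GSP.typeLaw f ν) o₁ →
      GSP.RespectsBound f (GSP.proposedRanking r) s (GSP.typeLaw f ν) o₁ →
        GSP.expectedRevenue (GSP.standardRanking r) s (GSP.typeLaw f ν) o₂ <
          GSP.expectedRevenue (GSP.proposedRanking r) s (GSP.typeLaw f ν) o₁) ∧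
    (∀ o₁ : GSP.Types n → GSP.Outcome n,
      GSP.SelectsLowestSNE (GSP.proposedRanking r) s (GSP.typeLaw f ν) o₁ →
        GSP.expectedRevenue (GSP.standardRanking r) s (GSP.typeLaw f ν) o₂ <
          GSP.expectedRevenue (GSP.proposedRanking r) s (GSP.typeLaw f ν) o₁) := by
  have hr_cdf : GSP.valueCDF f r < 1 := (GSP.valueCDF_mono f hr_le).trans_lt
    (GSP.valueCDF_lt_one_of_virtualValue_eq_zero (hr_pos.trans_le hr_le).ne' hθbar)
  have hlt (o₁) (h₁ : GSP.SelectsSNE (GSP.proposedRanking r) s (GSP.typeLaw f ν) o₁) :=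
    theorem2_general s (GSP.slotEffect_antitone hs.antitone fun k => (hs_pos k).le)
      (GSP.slotEffect_one_lt_zero hs hs_pos hm) f hf ν hw_pos hw_int hw_ne r hr_pos hr_cdf
      (fun t ht => hr t ht.le) o₁ o₂ h₁ h₂ h₂_bound
  exact ⟨fun o₁ h₁ _ => hlt o₁ h₁, fun o₁ h₁ => hlt o₁ h₁.selectsSNE⟩
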